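/- **Conventions.** An instance $I=(V,D,\mathcal C)$ of CSP consists of a finite set $V$ of $n$ variables, a finite domain $D$ with $\mathrm{dom}=|D|$, and a finite set $\mathcal C$ of constraints $(S,R)$, where $S$ is a non-empty sequence of distinct variables and $R$ is a set of tuples over $D$ of length $|S|$, given explicitly by listing its tuples. $I$ is consistent if some $\tau:V\to D$ satisfies $\tau(S)\in R$ for all $(S,R)\in\mathcal C$; CSP asks whether $I$ is consistent. $|I|$ is the length of the input, with names of variables and values written in unary. $I$ is *normalized* if every variable occurs in some scope and every domain element occurs in some relation (then $n$ and $\mathrm{dom}$ are at most $\sum_{(S,R)\in\mathcal C}|S|\max(|R|,1)$). For functions $f,g:\mathbb N\to\mathbb N$, $f(n)=o(g(n))$ means that $f,g$ are computable and that there are a computable nondecreasing unbounded $\mu:\mathbb N\to\mathbb N$ and $n_0$ with $f(n)\le g(n)/\mu(n)$ for all $n\ge n_0$. A restriction of CSP is solvable in *subexponential time* if a single algorithm decides all its instances $I$ in time $\max(\mathrm{dom},1)^{o(n)}|I|^{O(1)}$. The Exponential Time Hypothesis (ETH) states that for every $k\ge 3$, $k$-CNF-Sat (satisfiability of CNF formulas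 $F$ whose clauses have at most $k$ literals each) is not solvable in time $2^{o(n)}|F|^{O(1)}$, where $n$ is the number of variables of $F$. **Theorem.** 1. For every constant $c$, CSP restricted to instances with at most $c$ constraints is solvable in polynomial time $|I|^{O(1)}$. 2. Assume the ETH. Then for every computable, nondecreasing and unbounded function $\lambda:\mathbb N\to\mathbb N$, CSP restricted to normalized instances with at most $\lambda(n)$ constraints, where $n$ is the number of variables of the instance, is not solvable in subexponential time. In particular, CSP restricted to all instances with at most $\lambda(n)$ constraints is not solvable in subexponential time. -/

import Mathlib

/-! ## The machine model: WHILE programs over binary trees, with a step count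

This is the textbook language of Jones (Computability and Complexity from a Programming
Perspective).  The data are finite binary trees built from `nil` and `cons`; a program uses finitely
many variables holding trees and may only copy, pair, project and test for `nil`.  Each elementary
operation costs one step.  The model and multi-tape Turing machines simulate each other with
polynomial overhead, so polynomial time, and time `b ^ o(n) * |x| ^ O(1)`, mean the same in both. -/

namespace WhileLang

/-- Data: finite binary trees. -/
inductive Val : Type
  | nil : Val
  | cons : Val → Val → Val

namespace Val

/-- The number of nodes of a tree; this is the length of an input. -/
def size : Val → ℕ
  | nil => 1
  | cons a b => a.size + b.size + 1

/-- First component; `nil` for `nil`. -/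
def hd : Val → Val
  | nil => nil
  | cons a _ => a

/-- Second component; `nil` for `nil`. -/
def tl : Val → Val
  | nil => nil
  | cons _ b => b

/-- A number, written in unary. -/
def ofNat : ℕ → Val
  | 0 => nil
  | n + 1 => cons nil (ofNat n)

/-- A finite list of trees. -/
def ofList : List Val → Val
  | [] => nil
  | a :: l => cons a (ofList l)

/-- A truth value. -/
def ofBool : Bool → Val
  | false => nil
  | true => cons nil nil

end Val

/-- Expressions. -/
inductive Expr : Type
  | var : ℕ → Expr
  | nil : Expr
  | cons : Expr → Expr → Expr
  | hd : Expr → Expr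
  | tl : Expr → Expr

/-- A store assigns a tree to every variable. -/
abbrev Store : Type := ℕ → Val

namespace Expr

/-- The value of an expression. -/
def eval (s : Store) : Expr → Val
  | var i => s i
  | nil => Val.nil
  | cons e f => Val.cons (e.eval s) (f.eval s)
  | hd e => (e.eval s).hd
  | tl e => (e.eval s).tl

/-- The number of steps needed to evaluate an expression: one per operation. -/
def cost : Expr → ℕ
  | var _ => 1
  | nil => 1
  | cons e f => e.cost + f.cost + 1
  | hd e => e.cost + 1
  | tl e => e.cost + 1

end Expr

/-- Programs. -/
inductive Cmd : Type
  | skip : Cmd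
  | assign : ℕ → Expr → Cmd
  | seq : Cmd → Cmd → Cmd
  | ite : Expr → Cmd → Cmd → Cmd
  | while : Expr → Cmd → Cmd

/-- `Exec p s s' t`: started in the store `s`, the program `p` halts in the store `s'` after exactly
`t` steps.  Tests ask whether the value of an expression differs from `nil`. -/
inductive Exec : Cmd → Store → Store → ℕ → Prop
  | skip (s : Store) : Exec Cmd.skip s s 1
  | assign (i : ℕ) (e : Expr) (s : Store) :
      Exec (Cmd.assign i e) s (Function.update s i (e.eval s)) (e.cost + 1)
  | seq {p q : Cmd} {s s₁ s₂ : Store} {t₁ t₂ : ℕ} :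
      Exec p s s₁ t₁ → Exec q s₁ s₂ t₂ → Exec (Cmd.seq p q) s s₂ (t₁ + t₂)
  | iteTrue {e : Expr} {p q : Cmd} {s s₁ : Store} {t : ℕ} :
      e.eval s ≠ Val.nil → Exec p s s₁ t → Exec (Cmd.ite e p q) s s₁ (e.cost + 1 + t)
  | iteFalse {e : Expr} {p q : Cmd} {s s₁ : Store} {t : ℕ} :
      e.eval s = Val.nil → Exec q s s₁ t → Exec (Cmd.ite e p q) s s₁ (e.cost + 1 + t)
  | whileTrue {e : Expr} {p : Cmd} {s s₁ s₂ : Store} {t₁ t₂ : ℕ} :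
      e.eval s ≠ Val.nil → Exec p s s₁ t₁ → Exec (Cmd.while e p) s₁ s₂ t₂ →
      Exec (Cmd.while e p) s s₂ (e.cost + 1 + t₁ + t₂)
  | whileFalse {e : Expr} {p : Cmd} {s : Store} :
      e.eval s = Val.nil → Exec (Cmd.while e p) s s (e.cost + 1)

/-- Programs are deterministic: the final store and the number of steps are unique. -/
theorem Exec.deterministic {p : Cmd} {s s₁ s₂ : Store} {t₁ t₂ : ℕ}
    (h₁ : Exec p s s₁ t₁) (h₂ : Exec p s s₂ t₂) : s₁ = s₂ ∧ t₁ = t₂ := by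
  induction h₁ generalizing s₂ t₂ with
  | skip s => cases h₂; exact ⟨rfl, rfl⟩
  | assign i e s => cases h₂; exact ⟨rfl, rfl⟩
  | seq _ _ ih₁ ih₂ =>
    cases h₂ with
    | seq a b =>
      obtain ⟨rfl, rfl⟩ := ih₁ a
      obtain ⟨rfl, rfl⟩ := ih₂ b
      exact ⟨rfl, rfl⟩
  | iteTrue h _ ih =>
    cases h₂ with
    | iteTrue _ a => obtain ⟨rfl, rfl⟩ := ih a; exact ⟨rfl, rfl⟩
    | iteFalse h' _ => exact absurd h' h
  | iteFalse h _ ih =>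
    cases h₂ with
    | iteTrue h' _ => exact absurd h h'
    | iteFalse _ a => obtain ⟨rfl, rfl⟩ := ih a; exact ⟨rfl, rfl⟩
  | whileTrue h _ _ ih₁ ih₂ =>
    cases h₂ with
    | whileTrue _ a b =>
      obtain ⟨rfl, rfl⟩ := ih₁ a
      obtain ⟨rfl, rfl⟩ := ih₂ b
      exact ⟨rfl, rfl⟩
    | whileFalse h' => exact absurd h' h
  | whileFalse h =>
    cases h₂ with
    | whileTrue h' _ _ => exact absurd h h'
    | whileFalse _ => exact ⟨rfl, rfl⟩

/-- The initial store: the input is in variable `0`, all other variables hold `nil`. -/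
def initStore (x : Val) : Store := fun i => if i = 0 then x else Val.nil

/-- The program `p` decides the property `yes` on all instances in `K`, encoded by `code`, and on an
instance `x` in `K` it halts within `T x` steps.  The answer is read off variable `0`: anything
other than `nil` means yes. -/
def DecidesOn {α : Type} (p : Cmd) (code : α → Val) (K : Set α) (yes : α → Prop) (T : α → ℕ) :
    Prop :=
  ∀ x ∈ K, ∃ (s : Store) (t : ℕ),
    Exec p (initStore (code x)) s t ∧ t ≤ T x ∧ (s 0 ≠ Val.nil ↔ yes x)

/-- The problem `yes`, restricted to the instances in `K`, is solvable in polynomial time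
`|x| ^ O(1)`. -/
def PolyTimeOn {α : Type} (code : α → Val) (K : Set α) (yes : α → Prop) : Prop :=
  ∃ (p : Cmd) (a c : ℕ), DecidesOn p code K yes (fun x => a * (code x).size ^ c)

/-- The effective little-o relation `f(n) = o(g(n))` between computable functions: there are a
computable nondecreasing unbounded `μ` and an `n₀` with `f(n) ≤ g(n) / μ(n)` for all `n ≥ n₀`
(written without division; `μ n` is positive for all large `n`). -/
def EffLittleO (f g : ℕ → ℕ) : Prop :=
  Computable f ∧ Computable g ∧
    ∃ (μ : ℕ → ℕ) (n₀ : ℕ), Computable μ ∧ Monotone μ ∧ (∀ B, ∃ n, B ≤ μ n) ∧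
      ∀ n, n₀ ≤ n → f n * μ n ≤ g n

/-- The problem `yes`, restricted to the instances in `K`, is solvable in (uniform) subexponential
time: a single algorithm decides it in time `dom ^ o(n) * |x| ^ O(1)`, where `n = vars x` and
`dom = dom x`. -/
def SubexpTimeOn {α : Type} (code : α → Val) (vars dom : α → ℕ) (K : Set α) (yes : α → Prop) :
    Prop :=
  ∃ (p : Cmd) (f : ℕ → ℕ) (a c : ℕ), EffLittleO f (fun n => n) ∧
    DecidesOn p code K yes (fun x => a * dom x ^ f (vars x) * (code x).size ^ c)

end WhileLang

/-! ## Satisfiability of CNF formulas and the Exponential Time Hypothesis -/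

/-- A CNF formula over the variables `0, …, n - 1`: a list of clauses, each a list of literals.  The
literal `(i, true)` is the variable `i`, and `(i, false)` is its negation. -/
structure CNFFormula where
  n : ℕ
  clauses : List (List (Fin n × Bool))

namespace CNFFormula

/-- Some truth assignment makes at least one literal of every clause true. -/
def Satisfiable (F : CNFFormula) : Prop :=
  ∃ τ : Fin F.n → Bool, ∀ C ∈ F.clauses, ∃ l ∈ C, τ l.1 = l.2

/-- Every clause contains at most `k` literals. -/
def WidthLE (k : ℕ) (F : CNFFormula) : Prop :=
  ∀ C ∈ F.clauses, C.length ≤ k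

open WhileLang in
/-- The encoding of a formula as a tree. -/
def code (F : CNFFormula) : Val :=
  Val.cons (Val.ofNat F.n)
    (Val.ofList (F.clauses.map fun C =>
      Val.ofList (C.map fun l => Val.cons (Val.ofNat l.1) (Val.ofBool l.2))))

/-- The problem `k`-CNF-Sat is solvable in time `2 ^ o(n)`, up to a factor polynomial in the length
of the formula. -/
def KSatSubexp (k : ℕ) : Prop :=
  WhileLang.SubexpTimeOn code n (fun _ => 2) {F | F.WidthLE k} Satisfiable

end CNFFormula

/-- The Exponential Time Hypothesis: for every `k ≥ 3`, the problem `k`-CNF-Sat cannot be solved in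
time `2 ^ o(n)`, where `n` is the number of variables. -/
def ETH : Prop := ∀ k, 3 ≤ k → ¬ CNFFormula.KSatSubexp k

/-- The case `k = 3` is the whole hypothesis. -/
theorem eth_iff_three : ETH ↔ ¬ CNFFormula.KSatSubexp 3 := by
  refine ⟨fun h => h 3 le_rfl, fun h k hk => ?_⟩
  rintro ⟨p, f, a, c, hf, hp⟩
  exact h ⟨p, f, a, c, hf, fun F hF => hp F fun C hC => (hF C hC).trans hk⟩

/-! ## The constraint satisfaction problem -/

/-- A constraint `(S, R)` over the variables `0, …, n - 1` and the domain `{0, …, d - 1}`.  The scope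
`S` is a non-empty sequence of distinct variables, and `R` is a set of tuples of the same length,
given by listing its elements without repetition. -/
structure CSPConstraint (n d : ℕ) where
  scope : List (Fin n)
  tuples : List (List (Fin d))
  scope_ne_nil : scope ≠ []
  scope_nodup : scope.Nodup
  tuples_nodup : tuples.Nodup
  length_eq : ∀ r ∈ tuples, r.length = scope.length

namespace CSPConstraint

/-- An assignment satisfies `((x₁, …, x_m), R)` if `(τ x₁, …, τ x_m) ∈ R`. -/
def SatisfiedBy {n d : ℕ} (C : CSPConstraint n d) (τ : Fin n → Fin d) : Prop :=
  C.scope.map τ ∈ C.tuples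

/-- Two constraints are the same pair `(S, R)`; the order in which the tuples are listed does not
matter. -/
def Same {n d : ℕ} (C C' : CSPConstraint n d) : Prop :=
  C.scope = C'.scope ∧ ∀ r, r ∈ C.tuples ↔ r ∈ C'.tuples

end CSPConstraint

/-- An instance `(V, D, 𝒞)` of the CSP, with `V = {0, …, n - 1}` and `D = {0, …, d - 1}`.  The finite
set `𝒞` of constraints is given by listing its elements without repetition. -/
structure CSPInstance where
  n : ℕ
  d : ℕ
  constraints : List (CSPConstraint n d)
  distinct : constraints.Pairwise fun C C' => ¬ C.Same C'

namespace CSPInstance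

/-- The number of constraints. -/
def cons (I : CSPInstance) : ℕ := I.constraints.length

/-- Some assignment satisfies all constraints. -/
def Consistent (I : CSPInstance) : Prop :=
  ∃ τ : Fin I.n → Fin I.d, ∀ C ∈ I.constraints, C.SatisfiedBy τ

/-- Every variable occurs in some constraint scope, and every domain element occurs in some
constraint relation. -/
def Normalized (I : CSPInstance) : Prop :=
  (∀ x : Fin I.n, ∃ C ∈ I.constraints, x ∈ C.scope) ∧
    ∀ v : Fin I.d, ∃ C ∈ I.constraints, ∃ r ∈ C.tuples, v ∈ r

open WhileLang in
/-- The encoding of an instance as a tree: `n`, then `d`, then the list of constraints, each given by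
its scope and the list of its tuples. -/
def code (I : CSPInstance) : Val :=
  Val.cons (Val.ofNat I.n) (Val.cons (Val.ofNat I.d)
    (Val.ofList (I.constraints.map fun C =>
      Val.cons (Val.ofList (C.scope.map fun x => Val.ofNat x))
        (Val.ofList (C.tuples.map fun r => Val.ofList (r.map fun v => Val.ofNat v))))))

/-- The CSP restricted to the instances in `K` is solvable in polynomial time. -/
def PolyTime (K : Set CSPInstance) : Prop :=
  WhileLang.PolyTimeOn code K Consistent

/-- The CSP restricted to the instances in `K` is solvable in subexponential time
`dom ^ o(n) * |I| ^ O(1)`.  Taking `max d 1` for `dom` only keeps the bound from being `0` when the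
domain is empty. -/
def SubexpTime (K : Set CSPInstance) : Prop :=
  WhileLang.SubexpTimeOn code n (fun I => max I.d 1) K Consistent

end CSPInstance

/-! Tractability. Joining the constraints one after another produces a list of partial assignments,
and each constraint multiplies its length by at most the number of its tuples. With at most `c`
constraints the list stays below `|I| ^ c`, and the instance is consistent iff the final list is
non-empty (and a value exists for variables outside all scopes): `RawCSP.solve_iff`,
`RawCSP.length_join_le`.

Hardness. Let `g` grow slowly, with `g n ^ 3 + 1 ≤ lam n` whenever `2 ≤ g n`. Split the `n`
variables of a 3-CNF formula into `b = g n` residue classes modulo `b`. For every union `S` of three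
classes, impose the constraint listing all Boolean tuples on `S` that falsify no clause. A clause
has at most three variables, so it lies inside some `S`, and the instance is consistent iff the
formula is satisfiable (`reduction_consistent`). There are at most `b ^ 3` such constraints, one
more makes the instance normalized, and each scope has at most `3 * (n / b + 1) = o(n)` variables.
Hence the instance has size `2 ^ o(n) * |F| ^ O(1)`, and a subexponential algorithm for it would
refute the ETH (`kSatSubexp_of_subexpTime`).

The number of classes must itself be cheap to compute. Therefore `lam` is replaced by a lower bound
obtained from evaluation with bounded fuel (`exists_slow`), which rests on the polynomial running
time of such evaluation (`evalPT`).

Running times are controlled by the predicate `PT B f`: time and output size polynomial in the input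
size and a parameter `B`. It is closed under pairing, case distinction, folds and recursion, so
programs need not be written out. The parameter carries the non-polynomial quantities, namely
`joinBound` and `2 ^ scopeBound`. -/

namespace WhileLang

/-! ## Runs with a time bound -/

/-- `e.bound` exceeds the index of every variable of `e`. -/
def Expr.bound : Expr → ℕ
  | var i => i + 1
  | nil => 0
  | cons e f => max e.bound f.bound
  | hd e => e.bound
  | tl e => e.bound

/-- `p.bound` exceeds the index of every variable of `p`. -/
def Cmd.bound : Cmd → ℕ
  | skip => 0
  | assign i e => max (i + 1) e.bound
  | seq p q => max p.bound q.bound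
  | ite e p q => max e.bound (max p.bound q.bound)
  | .while e p => max e.bound p.bound

theorem Expr.eval_congr {e : Expr} {s r : Store} (h : ∀ i < e.bound, s i = r i) :
    e.eval s = e.eval r := by
  induction e with
  | var i => exact h i (by simp [Expr.bound])
  | nil => rfl
  | cons e f ihe ihf =>
    simp only [Expr.eval]
    rw [ihe fun i hi => h i (lt_max_of_lt_left hi), ihf fun i hi => h i (lt_max_of_lt_right hi)]
  | hd e ih => simp only [Expr.eval]; rw [ih h]
  | tl e ih => simp only [Expr.eval]; rw [ih h]

/-- Values stored at indices from `p.bound` on survive a run of `p`; this is how programs are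
combined without interference. -/
theorem Exec.frame {p : Cmd} {s s' : Store} {t : ℕ} (h : Exec p s s' t) :
    ∀ i, p.bound ≤ i → s' i = s i := by
  induction h with
  | skip s => intro i _; rfl
  | assign j e s =>
    intro i hi
    simp only [Cmd.bound, max_le_iff] at hi
    exact Function.update_of_ne (by omega) _ _
  | seq _ _ ih₁ ih₂ =>
    intro i hi
    simp only [Cmd.bound, max_le_iff] at hi
    rw [ih₂ i hi.2, ih₁ i hi.1]
  | iteTrue _ _ ih =>
    intro i hi
    simp only [Cmd.bound, max_le_iff] at hi
    exact ih i hi.2.1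
  | iteFalse _ _ ih =>
    intro i hi
    simp only [Cmd.bound, max_le_iff] at hi
    exact ih i hi.2.2
  | whileTrue _ _ _ ih₁ ih₂ =>
    intro i hi
    rw [ih₂ i hi]
    simp only [Cmd.bound, max_le_iff] at hi
    exact ih₁ i hi.2
  | whileFalse _ => intro i _; rfl

/-- A program reads only variables below its bound. Since `N` may be larger than the bound,
agreement can also be tracked on variable `0` when the program does not mention it. -/
theorem Exec.congr {p : Cmd} {s s' : Store} {t : ℕ} (h : Exec p s s' t) {N : ℕ}
    (hN : p.bound ≤ N) {r : Store} (hr : ∀ i < N, s i = r i) :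
    ∃ r', Exec p r r' t ∧ ∀ i < N, s' i = r' i := by
  induction h generalizing r with
  | skip s => exact ⟨r, .skip r, hr⟩
  | assign j e s =>
    simp only [Cmd.bound, max_le_iff] at hN
    refine ⟨_, .assign j e r, fun i hi => ?_⟩
    rw [Expr.eval_congr fun i hi => hr i (hi.trans_le hN.2)]
    simp only [Function.update_apply, hr i hi]
  | seq _ _ ih₁ ih₂ =>
    simp only [Cmd.bound, max_le_iff] at hN
    obtain ⟨r₁, h₁, e₁⟩ := ih₁ hN.1 hr
    obtain ⟨r₂, h₂, e₂⟩ := ih₂ hN.2 e₁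
    exact ⟨r₂, .seq h₁ h₂, e₂⟩
  | iteTrue h _ ih =>
    simp only [Cmd.bound, max_le_iff] at hN
    obtain ⟨r₁, h₁, e₁⟩ := ih hN.2.1 hr
    rw [Expr.eval_congr fun i hi => hr i (hi.trans_le hN.1)] at h
    exact ⟨r₁, .iteTrue h h₁, e₁⟩
  | iteFalse h _ ih =>
    simp only [Cmd.bound, max_le_iff] at hN
    obtain ⟨r₁, h₁, e₁⟩ := ih hN.2.2 hr
    rw [Expr.eval_congr fun i hi => hr i (hi.trans_le hN.1)] at h
    exact ⟨r₁, .iteFalse h h₁, e₁⟩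
  | whileTrue h _ _ ih₁ ih₂ =>
    have hN' := hN
    simp only [Cmd.bound, max_le_iff] at hN
    obtain ⟨r₁, h₁, e₁⟩ := ih₁ hN.2 hr
    obtain ⟨r₂, h₂, e₂⟩ := ih₂ hN' e₁
    rw [Expr.eval_congr fun i hi => hr i (hi.trans_le hN.1)] at h
    exact ⟨r₂, .whileTrue h h₁ h₂, e₂⟩
  | whileFalse h =>
    simp only [Cmd.bound, max_le_iff] at hN
    rw [Expr.eval_congr fun i hi => hr i (hi.trans_le hN.1)] at h
    exact ⟨r, .whileFalse h, hr⟩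

/-- Started in `s`, the program `p` halts within `T` steps, in a store with the property `Q`. -/
def Run (p : Cmd) (s : Store) (T : ℕ) (Q : Store → Prop) : Prop :=
  ∃ s' t, Exec p s s' t ∧ t ≤ T ∧ Q s'

namespace Run

variable {p q : Cmd} {s : Store} {T U : ℕ} {Q R : Store → Prop} {e : Expr}

theorem mono (h : Run p s T Q) (hT : T ≤ U) (hQ : ∀ s', Q s' → R s') : Run p s U R := by
  obtain ⟨s', t, h₁, h₂, h₃⟩ := h
  exact ⟨s', t, h₁, h₂.trans hT, hQ _ h₃⟩

theorem frame (h : Run p s T Q) : Run p s T fun s' => Q s' ∧ ∀ i, p.bound ≤ i → s' i = s i := by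
  obtain ⟨s', t, h₁, h₂, h₃⟩ := h
  exact ⟨s', t, h₁, h₂, h₃, h₁.frame⟩

theorem assign {i : ℕ} (h : Q (Function.update s i (e.eval s))) :
    Run (.assign i e) s (e.cost + 1) Q :=
  ⟨_, _, .assign i e s, le_rfl, h⟩

theorem seq (h : Run p s T Q) (h' : ∀ s', Q s' → Run q s' U R) : Run (.seq p q) s (T + U) R := by
  obtain ⟨s', t, h₁, h₂, h₃⟩ := h
  obtain ⟨s'', t', h₁', h₂', h₃'⟩ := h' s' h₃
  exact ⟨s'', _, .seq h₁ h₁', add_le_add h₂ h₂', h₃'⟩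

theorem ite (h : e.eval s ≠ .nil → Run p s T Q) (h' : e.eval s = .nil → Run q s T Q) :
    Run (.ite e p q) s (e.cost + 1 + T) Q := by
  by_cases he : e.eval s = .nil
  · obtain ⟨s', t, h₁, h₂, h₃⟩ := h' he
    exact ⟨s', _, .iteFalse he h₁, by omega, h₃⟩
  · obtain ⟨s', t, h₁, h₂, h₃⟩ := h he
    exact ⟨s', _, .iteTrue he h₁, by omega, h₃⟩

/-- A loop whose body leads from `I i` to `I (i + 1)`, and which has stopped when `I N` holds. -/
theorem whileLoop {I : ℕ → Store → Prop} {N : ℕ}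
    (hstep : ∀ i s, i < N → I i s → e.eval s ≠ .nil → Run p s T (I (i + 1)))
    (hend : ∀ s, I N s → e.eval s = .nil)
    (h_done : ∀ i s, i < N → I i s → e.eval s = .nil → I N s)
    (h : I 0 s) : Run (.while e p) s ((N + 1) * (e.cost + 1 + T)) fun s' => I N s' := by
  -- Induction on the number `m` of rounds still allowed; `h_done` covers a loop that stops early.
  suffices H : ∀ m i s, i + m = N → I i s →
      Run (.while e p) s ((m + 1) * (e.cost + 1 + T)) fun s' => I N s' from H N 0 s (by omega) h
  intro m
  induction m with
  | zero =>
    intro i s hi hs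
    obtain rfl : i = N := by omega
    exact ⟨s, _, .whileFalse (hend s hs), by simp, hs⟩
  | succ m ih =>
    intro i s hi hs
    by_cases he : e.eval s = .nil
    · exact ⟨s, _, .whileFalse he, by nlinarith, h_done i s (by omega) hs he⟩
    · obtain ⟨s₁, t₁, h₁, h₂, h₃⟩ := hstep i s (by omega) hs he
      obtain ⟨s₂, t₂, h₁', h₂', h₃'⟩ := ih (i + 1) s₁ (by omega) h₃
      exact ⟨s₂, _, .whileTrue he h₁ h₁', by nlinarith, h₃'⟩

end Run

/-- The program that sets the variables `1, …, N` to `nil`. -/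
def clear : ℕ → Cmd
  | 0 => .skip
  | N + 1 => .seq (clear N) (.assign (N + 1) .nil)

theorem run_clear (N : ℕ) (s : Store) :
    Run (clear N) s (2 * N + 1)
      fun s' => s' 0 = s 0 ∧ ∀ i, 0 < i → i ≤ N → s' i = .nil := by
  induction N with
  | zero => exact ⟨s, _, .skip s, by omega, rfl, by intros; omega⟩
  | succ N ih =>
    refine (ih.seq (U := 2) (R := fun s' => s' 0 = s 0 ∧ ∀ i, 0 < i → i ≤ N + 1 → s' i = .nil)
      fun s' hs' => Run.assign ?_).mono (by omega) fun _ h => h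
    refine ⟨by simp [hs'.1], fun i h0 hi => ?_⟩
    by_cases h : i = N + 1
    · subst h; simp [Expr.eval]
    · rw [Function.update_of_ne h]; exact hs'.2 i h0 (by omega)

/-- A run from the initial store can be started from any store by first clearing the variables. -/
theorem run_clear_seq {p : Cmd} {x : Val} {s' : Store} {t : ℕ} (h : Exec p (initStore x) s' t)
    {s : Store} (hs : s 0 = x) :
    Run (.seq (clear p.bound) p) s (2 * p.bound + 1 + t) fun s'' => s'' 0 = s' 0 := by
  refine (run_clear p.bound s).seq fun s₁ h₁ => ?_
  -- Clearing has made the variables `0, …, p.bound` agree with the initial store; the `+ 1` keeps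
  -- the answer variable `0` in range even if `p.bound = 0`.
  obtain ⟨r, hr, e⟩ := h.congr (N := p.bound + 1) (by omega) (r := s₁) fun i hi => by
    by_cases h0 : i = 0
    · subst h0; simp [initStore, h₁.1, hs]
    · rw [h₁.2 i (by omega) (by omega)]; simp [initStore, h0]
  exact ⟨r, t, hr, le_rfl, (e 0 (by omega)).symm⟩

/-! ## Encodings -/

/-- Types whose elements can be written as trees. -/
class Enc (α : Type) where
  enc : α → Val

open Enc (enc)

instance : Enc Val := ⟨id⟩
instance : Enc ℕ := ⟨Val.ofNat⟩
instance : Enc Bool := ⟨Val.ofBool⟩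
instance : Enc Unit := ⟨fun _ => .nil⟩
instance {α : Type} [Enc α] : Enc (List α) := ⟨fun l => Val.ofList (l.map enc)⟩
instance {α β : Type} [Enc α] [Enc β] : Enc (α × β) := ⟨fun x => .cons (enc x.1) (enc x.2)⟩

variable {α β γ δ σ ρ : Type} [Enc α] [Enc β] [Enc γ] [Enc δ] [Enc σ] [Enc ρ]

/-- The length of the encoding. -/
def sz (x : α) : ℕ := (enc x).size

theorem enc_prod (x : α × β) : enc x = .cons (enc x.1) (enc x.2) := rfl
theorem enc_nil : enc ([] : List α) = .nil := rfl
theorem enc_cons (a : α) (l : List α) : enc (a :: l) = .cons (enc a) (enc l) := rfl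
theorem enc_succ (n : ℕ) : enc (n + 1) = .cons .nil (enc n) := rfl

theorem Val.size_pos (v : Val) : 0 < v.size := by cases v <;> simp [Val.size]

theorem sz_pos (x : α) : 0 < sz x := Val.size_pos _
theorem sz_prod (x : α × β) : sz x = sz x.1 + sz x.2 + 1 := rfl
theorem sz_mk (a : α) (b : β) : sz (a, b) = sz a + sz b + 1 := rfl
theorem sz_nil : sz ([] : List α) = 1 := rfl
theorem sz_cons (a : α) (l : List α) : sz (a :: l) = sz a + sz l + 1 := rfl
theorem sz_nat (n : ℕ) : sz n = 2 * n + 1 := by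
  induction n with
  | zero => rfl
  | succ n ih => simp only [sz, enc_succ, Val.size] at ih ⊢; omega
theorem sz_bool (b : Bool) : sz b ≤ 3 := by
  cases b <;> simp [sz, enc, Val.ofBool, Val.size]

theorem sz_append (l m : List α) : sz (l ++ m) + 1 = sz l + sz m := by
  induction l with
  | nil => simp [sz_nil]; omega
  | cons a l ih => simp only [List.cons_append, sz_cons]; omega

theorem sz_reverse (l : List α) : sz l.reverse = sz l := by
  induction l with
  | nil => rfl
  | cons a l ih =>
    have := sz_append l.reverse [a]
    simp only [List.reverse_cons, sz_cons, sz_nil] at this ⊢; omega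

theorem length_lt_sz (l : List α) : l.length < sz l := by
  induction l with
  | nil => simp [sz_nil]
  | cons a l ih => simp only [List.length_cons, sz_cons]; omega

theorem sz_lt_of_mem {l : List α} {a : α} (h : a ∈ l) : sz a < sz l := by
  induction l with
  | nil => simp at h
  | cons b l ih =>
    rw [sz_cons]
    rcases List.mem_cons.1 h with rfl | h
    · omega
    · have := ih h; omega

theorem sz_le_of_forall {l : List α} {K : ℕ} (h : ∀ a ∈ l, sz a ≤ K) :
    sz l ≤ l.length * (K + 1) + 1 := by
  induction l with
  | nil => simp [sz_nil]
  | cons a l ih =>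
    have := ih fun b hb => h b (List.mem_cons_of_mem _ hb)
    have := h a List.mem_cons_self
    rw [sz_cons, List.length_cons]; nlinarith

theorem sz_le_of_prefix {l m : List α} (h : l <+: m) : sz l ≤ sz m := by
  obtain ⟨k, rfl⟩ := h
  have := sz_append l k
  have := sz_pos k
  omega

theorem enc_injective_nat : Function.Injective (enc : ℕ → Val) := by
  intro a b h
  have : sz a = sz b := congrArg Val.size h
  rw [sz_nat, sz_nat] at this; omega

theorem enc_injective_bool : Function.Injective (enc : Bool → Val) := by
  intro a b h
  cases a <;> cases b <;> simp_all [enc, Val.ofBool]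

theorem enc_injective_list (h : Function.Injective (enc : α → Val)) :
    Function.Injective (enc : List α → Val) := by
  intro l
  induction l with
  | nil => intro m hm; cases m with
    | nil => rfl
    | cons b m => simp [enc_nil, enc_cons] at hm
  | cons a l ih => intro m hm; cases m with
    | nil => simp [enc_nil, enc_cons] at hm
    | cons b m =>
      simp only [enc_cons, Val.cons.injEq] at hm
      rw [h hm.1, ih hm.2]

theorem enc_injective_prod (h : Function.Injective (enc : α → Val))
    (h' : Function.Injective (enc : β → Val)) : Function.Injective (enc : α × β → Val) := by
  rintro ⟨a, b⟩ ⟨c, d⟩ hm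
  simp only [enc_prod, Val.cons.injEq] at hm
  rw [h hm.1, h' hm.2]

/-! ## Polynomial bounds -/

/-- Functions with natural numbers as values that serve as the parameter of a bound. -/
abbrev Param (α : Type) : Type := α → ℕ

/-- `T` is bounded by a polynomial in `B` and the size of the argument. -/
@[fun_prop]
def PB (B : Param α) (T : α → ℕ) : Prop := ∃ e, ∀ x, T x ≤ (B x + sz x + 1) ^ e

/-- A base of at least `2` lets powers absorb constants and sums, so a single exponent suffices as a
polynomial bound. -/
theorem two_le_base (B : α → ℕ) (x : α) : 2 ≤ B x + sz x + 1 := by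
  have := sz_pos x; omega

namespace PB

variable {B T U : α → ℕ}

theorem mono (hU : PB B U) (h : ∀ x, T x ≤ U x) : PB B T := by
  obtain ⟨e, he⟩ := hU
  exact ⟨e, fun x => (h x).trans (he x)⟩

@[fun_prop]
theorem const (k : ℕ) : PB B fun _ => k :=
  ⟨k, fun x => (Nat.lt_two_pow_self).le.trans (Nat.pow_le_pow_left (two_le_base B x) k)⟩

theorem base : PB B fun x => B x + sz x + 1 := ⟨1, fun x => by simp⟩

@[fun_prop]
theorem self : PB B B := base.mono fun x => by omega

theorem size : PB B fun x => sz x := base.mono fun x => by omega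

@[fun_prop]
theorem mul (hT : PB B T) (hU : PB B U) : PB B fun x => T x * U x := by
  obtain ⟨e, he⟩ := hT
  obtain ⟨f, hf⟩ := hU
  exact ⟨e + f, fun x => by rw [pow_add]; exact Nat.mul_le_mul (he x) (hf x)⟩

@[fun_prop]
theorem add (hT : PB B T) (hU : PB B U) : PB B fun x => T x + U x := by
  obtain ⟨e, he⟩ := hT
  obtain ⟨f, hf⟩ := hU
  refine ⟨1 + (e + f), fun x => ?_⟩
  have h2 := two_le_base B x
  have h1 : (B x + sz x + 1) ^ e ≤ (B x + sz x + 1) ^ (e + f) :=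
    Nat.pow_le_pow_right (by omega) (by omega)
  have h3 : (B x + sz x + 1) ^ f ≤ (B x + sz x + 1) ^ (e + f) :=
    Nat.pow_le_pow_right (by omega) (by omega)
  have := he x
  have := hf x
  rw [pow_add _ 1, pow_one]
  nlinarith

@[fun_prop]
theorem pow (hT : PB B T) (k : ℕ) : PB B fun x => T x ^ k := by
  induction k with
  | zero => simpa using const 1
  | succ k ih => simpa only [pow_succ] using ih.mul hT

theorem comp {B' T' : β → ℕ} {f : α → β} (h : PB B' T') (hB : PB B fun x => B' (f x))
    (hf : PB B fun x => sz (f x)) : PB B fun x => T' (f x) := by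
  obtain ⟨e, he⟩ := h
  exact (((hB.add hf).add (const 1)).pow e).mono fun x => he (f x)

end PB

/-! ## Functions computable in polynomial time -/

/-- The program `p` computes the value `y` from `x` within `T` steps. -/
def Computes (p : Cmd) (x : α) (y : β) (T : ℕ) : Prop :=
  ∀ s : Store, s 0 = enc x → Run p s T fun s' => s' 0 = enc y

/-- `f` is computable in time polynomial in `B` and the size of the argument, and its values have
polynomial size in the same sense. -/
@[fun_prop]
def PT (B : Param α) (f : α → β) : Prop :=
  (∃ (p : Cmd) (T : α → ℕ), PB B T ∧ ∀ x, Computes p x (f x) (T x)) ∧ PB B fun x => sz (f x)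

namespace PT

variable {B : α → ℕ}

@[fun_prop]
theorem sz {f : α → β} (h : PT B f) : PB B fun x => sz (f x) := h.2

/-- Programs see only encodings. This identifies `n + 1` with a pair of a dummy and `n`, a non-empty
list with the pair of head and tail, and truth values with the numbers `0` and `1`. -/
theorem recode {f : α → β} {g : α → γ} (h : PT B f) (e : ∀ x, enc (g x) = enc (f x)) : PT B g := by
  obtain ⟨⟨p, T, hT, hp⟩, hs⟩ := h
  refine ⟨⟨p, T, hT, fun x s hs => ?_⟩, ?_⟩
  · rw [e]; exact hp x s hs
  · simpa only [WhileLang.sz, e] using hs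

theorem congr {f g : α → β} (h : PT B f) (e : ∀ x, g x = f x) : PT B g :=
  h.recode fun x => by rw [e]

theorem comp {B' : β → ℕ} {g : β → γ} {f : α → β} (hg : PT B' g) (hf : PT B f)
    (hB : PB B fun x => B' (f x)) : PT B fun x => g (f x) := by
  obtain ⟨⟨p, T, hT, hp⟩, hs⟩ := hf
  obtain ⟨⟨q, U, hU, hq⟩, hs'⟩ := hg
  exact ⟨⟨.seq p q, fun x => T x + U (f x), hT.add (hU.comp hB hs),
    fun x s h => (hp x s h).seq fun s' h' => hq _ s' h'⟩, hs'.comp hB hs⟩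

-- With parameter `0` the outer function is polynomial outright, so composition needs no side
-- condition and can be left to `fun_prop`.
@[fun_prop]
theorem comp₀ {g : β → γ} {f : α → β} (hg : PT (fun _ => 0) g) (hf : PT B f) :
    PT B fun x => g (f x) :=
  hg.comp hf (.const 0)

/-- Functions given by an expression. -/
theorem ofExpr {f : α → β} {g : α → γ} (h : PT B f) (e : Expr)
    (he : ∀ x s, s 0 = enc (f x) → e.eval s = enc (g x))
    (hs : PB B fun x => WhileLang.sz (g x)) : PT B g := by
  obtain ⟨⟨p, T, hT, hp⟩, -⟩ := h
  exact ⟨⟨.seq p (.assign 0 e), fun x => T x + (e.cost + 1), hT.add (.const _),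
    fun x s h => (hp x s h).seq fun s' h' => Run.assign (by simp [he x s' h'])⟩, hs⟩

@[fun_prop]
theorem id : PT B fun x : α => x :=
  ⟨⟨.skip, fun _ => 1, .const _, fun _ s h => ⟨s, 1, .skip s, le_rfl, h⟩⟩, PB.size⟩

/-- An expression without variables for a tree. -/
def _root_.WhileLang.Val.expr : Val → Expr
  | .nil => .nil
  | .cons a b => .cons a.expr b.expr

theorem _root_.WhileLang.Val.eval_expr (v : Val) (s : Store) : v.expr.eval s = v := by
  induction v with
  | nil => rfl
  | cons a b iha ihb => simp [Val.expr, Expr.eval, iha, ihb]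

@[fun_prop]
theorem const (b : β) : PT B fun _ : α => b :=
  ofExpr id (enc b).expr (fun _ s _ => Val.eval_expr _ s) (.const _)

@[fun_prop]
theorem fst {f : α → β × γ} (h : PT B f) : PT B fun x => (f x).1 :=
  ofExpr h (.hd (.var 0)) (fun x s hs => by simp [Expr.eval, hs, enc_prod, Val.hd])
    (h.2.mono fun x => by simp only [sz_prod]; omega)

@[fun_prop]
theorem snd {f : α → β × γ} (h : PT B f) : PT B fun x => (f x).2 :=
  ofExpr h (.tl (.var 0)) (fun x s hs => by simp [Expr.eval, hs, enc_prod, Val.tl])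
    (h.2.mono fun x => by simp only [sz_prod]; omega)

@[fun_prop]
theorem prodMk {f : α → β} {g : α → γ} (hf : PT B f) (hg : PT B g) :
    PT B fun x => (f x, g x) := by
  obtain ⟨⟨p, T, hT, hp⟩, hs⟩ := hf
  obtain ⟨⟨q, U, hU, hq⟩, hs'⟩ := hg
  refine ⟨?_, ((hs.add hs').add (.const 1)).mono fun x => le_rfl⟩
  -- `N` is beyond all variables of `p` and `q` and differs from `0`, so the input and the first
  -- result can be kept in `N` and `N + 1`.
  set N := max p.bound q.bound + 1 with hN
  have h1 : p.bound ≤ N := by omega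
  have h2 : q.bound ≤ N := by omega
  refine ⟨.seq (.assign N (.var 0)) (.seq p (.seq (.assign (N + 1) (.var 0))
    (.seq (.assign 0 (.var N)) (.seq q (.assign 0 (.cons (.var (N + 1)) (.var 0))))))),
    fun x => 2 + (T x + (2 + (2 + (U x + 4)))), ?_, fun x s h => ?_⟩
  · exact (PB.const _).add (hT.add ((PB.const _).add ((PB.const _).add (hU.add (PB.const _)))))
  refine Run.seq (Q := fun s => s 0 = enc x ∧ s N = enc x)
    (Run.assign ⟨?_, by simp [Expr.eval, h]⟩) fun s h => ?_
  · rw [Function.update_of_ne (by omega), h]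
  refine Run.seq (Q := fun s => s 0 = enc (f x) ∧ s N = enc x)
    ((hp x s h.1).frame.mono le_rfl fun s' h' => ⟨h'.1, by rw [h'.2 _ h1, h.2]⟩) fun s h => ?_
  refine Run.seq (Q := fun s => s N = enc x ∧ s (N + 1) = enc (f x))
    (Run.assign ⟨?_, by simp [Expr.eval, h.1]⟩) fun s h => ?_
  · rw [Function.update_of_ne (by omega), h.2]
  refine Run.seq (Q := fun s => s 0 = enc x ∧ s (N + 1) = enc (f x))
    (Run.assign ⟨by simp [Expr.eval, h.1], ?_⟩) fun s h => ?_
  · rw [Function.update_of_ne (by omega), h.2]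
  refine Run.seq (Q := fun s => s 0 = enc (g x) ∧ s (N + 1) = enc (f x))
    ((hq x s h.1).frame.mono le_rfl fun s' h' => ⟨h'.1, by rw [h'.2 _ (by omega), h.2]⟩)
    fun s h => ?_
  exact Run.assign (by simp [Expr.eval, h.1, h.2, enc_prod])

/-- Case distinction on an optional pair, written as `nil` or as the pair. -/
theorem optionCases {h : α → δ} {o : α → Option (β × γ)} {f : α → σ} {g : α → β × γ → σ}
    {B' : α × (β × γ) → ℕ} (hh : PT B h)
    (ho : ∀ x, enc (h x) = (o x).elim .nil enc)
    (hf : PT B f) (hg : PT B' fun q => g q.1 q.2)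
    {T : α → ℕ} (hT : PB B T) (hB : ∀ x q, o x = some q → B' (x, q) ≤ T x) :
    PT B fun x => (o x).elim (f x) (g x) := by
  obtain ⟨⟨p, T₁, hT₁, hp⟩, hs⟩ := hh
  obtain ⟨⟨q, T₂, hT₂, hq⟩, hs'⟩ := hf
  obtain ⟨⟨r, T₃, ⟨e, hT₃⟩, hr⟩, ⟨e', hs''⟩⟩ := hg
  -- The payload `q` has the same encoding as `h x`, so its size is already under control.
  have key : ∀ x q, o x = some q →
      B' (x, q) + WhileLang.sz (x, q) + 1 ≤ T x + WhileLang.sz x + WhileLang.sz (h x) + 2 := by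
    intro x q hq
    have h1 : WhileLang.sz (h x) = WhileLang.sz q := by simp [WhileLang.sz, ho, hq]
    have := hB x q hq
    rw [sz_mk, h1]; omega
  have hK : ∀ k, PB B fun x => (T x + WhileLang.sz x + WhileLang.sz (h x) + 2) ^ k := fun k =>
    (((hT.add .size).add hs).add (.const 2)).pow k
  constructor
  · set N := max p.bound (max q.bound r.bound) + 1 with hN
    have h1 : p.bound ≤ N := by omega
    refine ⟨.seq (.assign N (.var 0)) (.seq p (.ite (.var 0)
      (.seq (.assign 0 (.cons (.var N) (.var 0))) r) (.seq (.assign 0 (.var N)) q))),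
      fun x => 2 + (T₁ x + (2 + (4 + (T₂ x +
        (T x + WhileLang.sz x + WhileLang.sz (h x) + 2) ^ e)))), ?_, fun x s hx => ?_⟩
    · exact (PB.const _).add (hT₁.add ((PB.const _).add ((PB.const _).add (hT₂.add (hK e)))))
    refine Run.seq (Q := fun s => s 0 = enc x ∧ s N = enc x)
      (Run.assign ⟨?_, by simp [Expr.eval, hx]⟩) fun s hx => ?_
    · rw [Function.update_of_ne (by omega), hx]
    refine Run.seq (Q := fun s => s 0 = enc (h x) ∧ s N = enc x)
      ((hp x s hx.1).frame.mono le_rfl fun s' h' => ⟨h'.1, by rw [h'.2 _ h1, hx.2]⟩) fun s hx => ?_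
    refine Run.ite (fun hc => ?_) fun hc => ?_
    · simp only [Expr.eval, hx.1] at hc
      rw [ho] at hc hx
      rcases hox : o x with _ | y
      · simp [hox] at hc
      · rw [hox] at hx
        refine Run.seq (Q := fun s => s 0 = enc (x, y))
          (Run.assign (by simp [Expr.eval, hx.1, hx.2, enc_prod (x, y)])) fun s hx => ?_
        refine (hr (x, y) s hx).mono ?_ fun s h => by simpa [hox] using h
        exact (hT₃ _).trans ((Nat.pow_le_pow_left (key x y hox) e).trans (by omega))
    · simp only [Expr.eval, hx.1] at hc
      rw [ho] at hc
      rcases hox : o x with _ | y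
      · refine (Run.seq (Q := fun s => s 0 = enc x)
          (Run.assign (by simp [Expr.eval, hx.2])) fun s hx => hq x s hx).mono ?_
          fun s h => by simpa [hox] using h
        simp only [Expr.cost]; omega
      · simp [hox, enc_prod] at hc
  · refine (hs'.add (hK e')).mono fun x => ?_
    rcases hox : o x with _ | y
    · simp [hox]
    · simp only [hox]
      exact (hs'' (x, y)).trans ((Nat.pow_le_pow_left (key x y hox) e').trans (by omega))

/-- Repetition of `step` until the list in the first component of the state is empty. -/
theorem loop {init : α → List β × γ} {step : List β × γ → List β × γ} {B' : List β × γ → ℕ}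
    (hi : PT B init) (hs : PT B' step) (hfix : ∀ r, step ([], r) = ([], r))
    {N T : α → ℕ} (hN : PB B N) (hT : PB B T)
    (hend : ∀ x, (step^[N x] (init x)).1 = [])
    (hsz : ∀ x i, i ≤ N x → WhileLang.sz (step^[i] (init x)) ≤ T x)
    (hB : ∀ x i, i ≤ N x → (step^[i] (init x)).1 ≠ [] → B' (step^[i] (init x)) ≤ T x) :
    PT B fun x => (step^[N x] (init x)).2 := by
  obtain ⟨⟨p, T₁, hT₁, hp⟩, -⟩ := hi
  obtain ⟨⟨q, T₂, ⟨e, hT₂⟩, hq⟩, -⟩ := hs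
  have hK : PB B fun x => (T x + T x + 1) ^ e := ((hT.add hT).add (.const 1)).pow e
  refine ⟨⟨.seq p (.seq (.while (.hd (.var 0)) q) (.assign 0 (.tl (.var 0)))),
    fun x => T₁ x + ((N x + 1) * (2 + 1 + (T x + T x + 1) ^ e) + 3), ?_, fun x s hx => ?_⟩, ?_⟩
  · exact hT₁.add (((hN.add (.const 1)).mul ((PB.const _).add hK)).add (.const _))
  · refine Run.seq (hp x s hx) fun s hx => ?_
    refine Run.seq (Q := fun s => s 0 = enc (step^[N x] (init x))) ?_ fun s hx =>
      Run.assign (by simp [Expr.eval, hx, enc_prod (step^[N x] (init x)), Val.tl])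
    have hnil : ∀ i (s : Store), s 0 = enc (step^[i] (init x)) →
        ((Expr.hd (.var 0)).eval s = .nil ↔ (step^[i] (init x)).1 = []) := by
      intro i s hs
      simp only [Expr.eval, hs, enc_prod (step^[i] (init x)), Val.hd]
      cases (step^[i] (init x)).1 <;> simp [enc_nil, enc_cons]
    refine Run.whileLoop (I := fun i s => s 0 = enc (step^[i] (init x))) (N := N x)
      (fun i s hi hs he => ?_) (fun s hs => (hnil _ s hs).2 (hend x)) (fun i s hi hs he => ?_) hx
    · have h1 := hB x i hi.le fun h => he ((hnil i s hs).2 h)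
      have h2 := hsz x i hi.le
      simp only [Function.iterate_succ_apply']
      exact (hq _ s hs).mono ((hT₂ _).trans (Nat.pow_le_pow_left (by omega) e)) fun _ h => h
    · have h1 := (hnil i s hs).1 he
      -- A state with empty list is fixed by `step`, so a loop that stops after `i` rounds holds the
      -- same state as after `N x` rounds.
      have h2 : ∀ j, step^[j + i] (init x) = step^[i] (init x) := by
        intro j
        induction j with
        | zero => simp
        | succ j ih =>
          rw [Nat.succ_add, Function.iterate_succ_apply', ih]
          rcases hst : step^[i] (init x) with ⟨l, r⟩
          rw [hst] at h1
          obtain rfl : l = [] := h1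
          exact hfix r
      have := h2 (N x - i)
      rw [Nat.sub_add_cancel hi.le] at this
      rw [hs, this]
  · refine hT.mono fun x => le_trans ?_ (hsz x (N x) le_rfl)
    have := sz_prod (step^[N x] (init x))
    dsimp only; omega

end PT

/-- The two components of a tree. -/
def Val.uncons : Val → Option (Val × Val)
  | .nil => none
  | .cons a b => some (a, b)

/-- The head and the tail of a list. -/
def listUncons {β : Type} : List β → Option (β × List β)
  | [] => none
  | b :: l => some (b, l)

/-- The predecessor of a number, with a dummy component. -/
def natUncons : ℕ → Option (Unit × ℕ)
  | 0 => none
  | n + 1 => some ((), n)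

/-- A truth value as an optional pair of dummies. -/
def boolUncons : Bool → Option (Unit × Unit)
  | false => none
  | true => some ((), ())

theorem sz_zip_le (l : List α) (m : List β) : sz (l.zip m) ≤ sz l + sz m := by
  induction l generalizing m with
  | nil => simp [sz_nil]
  | cons b k ih =>
    cases m with
    | nil => simp [sz_nil]
    | cons c n => have := ih n; simp only [List.zip_cons_cons, sz_cons, sz_mk] at *; omega

namespace PT

variable {B : α → ℕ}

/-! ### Case distinctions -/

@[fun_prop]
theorem cons {f : α → β} {l : α → List β} (hf : PT B f) (hl : PT B l) :
    PT B fun x => f x :: l x :=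
  (hf.prodMk hl).recode fun _ => rfl

/-- The branch may have its own parameter `B'`, which must be bounded only on values that actually
occur. The primed variants keep the parameter `B`, a form `fun_prop` can apply. -/
theorem listElim {l : α → List β} {f : α → σ} {g : α → β × List β → σ}
    {B' : α × (β × List β) → ℕ} (hl : PT B l) (hf : PT B f) (hg : PT B' fun q => g q.1 q.2)
    {T : α → ℕ} (hT : PB B T) (hB : ∀ x q, listUncons (l x) = some q → B' (x, q) ≤ T x) :
    PT B fun x => (listUncons (l x)).elim (f x) (g x) :=
  optionCases hl (fun x => by cases l x <;> rfl) hf hg hT hB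

@[fun_prop]
theorem listElim' {l : α → List β} {f : α → σ} {g : α → β × List β → σ}
    (hl : PT B l) (hf : PT B f)
    (hg : PT (fun q : α × (β × List β) => B q.1) fun q => g q.1 q.2) :
    PT B fun x => (listUncons (l x)).elim (f x) (g x) :=
  listElim hl hf hg .self fun _ _ _ => le_rfl

@[fun_prop]
theorem valElim {v : α → Val} {f : α → σ} {g : α → Val × Val → σ}
    (hv : PT B v) (hf : PT B f) (hg : PT (fun q : α × (Val × Val) => B q.1) fun q => g q.1 q.2) :
    PT B fun x => (v x).uncons.elim (f x) (g x) :=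
  optionCases hv (fun x => by cases v x <;> rfl) hf hg .self fun _ _ _ => le_rfl

@[fun_prop]
theorem natElim {n : α → ℕ} {f : α → σ} {g : α → Unit × ℕ → σ}
    (hn : PT B n) (hf : PT B f) (hg : PT (fun q : α × (Unit × ℕ) => B q.1) fun q => g q.1 q.2) :
    PT B fun x => (natUncons (n x)).elim (f x) (g x) :=
  optionCases hn (fun x => by cases n x <;> rfl) hf hg .self fun _ _ _ => le_rfl

theorem comp_fst {f : α → σ} (hf : PT B f) : PT (fun q : α × β => B q.1) fun q => f q.1 :=
  hf.comp (by fun_prop) .self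

@[fun_prop]
theorem ite {c : α → Bool} {f g : α → σ} (hc : PT B c) (hf : PT B f) (hg : PT B g) :
    PT B fun x => if c x then f x else g x := by
  have := optionCases (B := B) (o := fun x => boolUncons (c x)) (f := g)
    (g := fun x _ => f x) hc (fun x => by cases c x <;> rfl) hg
    hf.comp_fst PB.self fun _ _ _ => le_rfl
  exact this.congr fun x => by cases c x <;> rfl

@[fun_prop]
theorem and {f g : α → Bool} (hf : PT B f) (hg : PT B g) : PT B fun x => f x && g x :=
  (hf.ite hg (.const false)).congr fun x => by cases f x <;> rfl

@[fun_prop]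
theorem or {f g : α → Bool} (hf : PT B f) (hg : PT B g) : PT B fun x => f x || g x :=
  (hf.ite (.const true) hg).congr fun x => by cases f x <;> rfl

@[fun_prop]
theorem not {f : α → Bool} (hf : PT B f) : PT B fun x => !f x :=
  (hf.ite (.const false) (.const true)).congr fun x => by cases f x <;> rfl

@[fun_prop]
theorem isEmpty {l : α → List β} (hl : PT B l) : PT B fun x => (l x).isEmpty :=
  (hl.listElim' (.const true) (g := fun _ _ => false) (.const false)).congr fun x => by cases l x <;> rfl

/-! ### Iteration -/

/-- The loop state holds the unread part of the list, the argument and the accumulator. A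
polynomial-time step alone does not prevent exponential growth under iteration, so the accumulator
must be bounded on every prefix (`hsz`). -/
theorem foldl {l : α → List β} {init : α → σ} {step : α → σ → β → σ} {B' : α × σ × β → ℕ}
    (hl : PT B l) (hi : PT B init) (hs : PT B' fun q => step q.1 q.2.1 q.2.2)
    {T : α → ℕ} (hT : PB B T)
    (hsz : ∀ x m, m <+: l x → WhileLang.sz (m.foldl (step x) (init x)) ≤ T x)
    (hB : ∀ x m b, m ++ [b] <+: l x → B' (x, m.foldl (step x) (init x), b) ≤ T x) :
    PT B fun x => (l x).foldl (step x) (init x) := by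
  set st : List β × (α × σ) → List β × (α × σ) := fun u =>
    (listUncons u.1).elim u fun q => (q.2, u.2.1, step u.2.1 u.2.2 q.1) with hst
  set Bst : List β × (α × σ) → ℕ := fun u =>
    (listUncons u.1).elim 0 fun q => B' (u.2.1, u.2.2, q.1) with hBst
  have hPT : PT Bst st := by
    refine listElim (by fun_prop) (by fun_prop)
      (B' := fun w : (List β × (α × σ)) × (β × List β) => B' (w.1.2.1, w.1.2.2, w.2.1))
      ?_ .self fun u q hq => by simp [hBst, hq]
    refine prodMk (by fun_prop) (prodMk (by fun_prop) ?_)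
    exact hs.comp (f := fun w : (List β × (α × σ)) × (β × List β) => (w.1.2.1, w.1.2.2, w.2.1))
      (by fun_prop) .self
  have hit : ∀ x i, st^[i] (l x, x, init x) =
      ((l x).drop i, x, ((l x).take i).foldl (step x) (init x)) := by
    intro x i
    induction i with
    | zero => simp
    | succ i ih =>
      rw [Function.iterate_succ_apply', ih]
      by_cases h : i < (l x).length
      · rw [List.drop_eq_getElem_cons h, List.take_succ_eq_append_getElem h, List.foldl_append]
        rfl
      · rw [List.drop_eq_nil_of_le (by omega), List.drop_eq_nil_of_le (by omega),
          List.take_of_length_le (by omega), List.take_of_length_le (by omega)]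
        rfl
  have := (loop (B := B) (init := fun x => (l x, x, init x)) (step := st) (B' := Bst)
    -- More rounds than the length of the list; the surplus ones change nothing.
    (N := fun x => WhileLang.sz (l x))
    (T := fun x => WhileLang.sz (l x) + WhileLang.sz x + T x + 2)
    (by fun_prop) hPT (fun r => rfl) (by fun_prop) (by fun_prop) (fun x => ?_) (fun x i _ => ?_)
    fun x i _ h => ?_).snd
  · refine this.congr fun x => ?_
    rw [hit, List.take_of_length_le (length_lt_sz _).le]
  · rw [hit, List.drop_eq_nil_of_le (length_lt_sz _).le]
  · rw [hit, sz_mk, sz_mk]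
    have h1 := hsz x _ (List.take_prefix i (l x))
    have h2 : WhileLang.sz ((l x).drop i) ≤ WhileLang.sz (l x) := by
      conv_rhs => rw [← List.take_append_drop i (l x)]
      have := sz_append ((l x).take i) ((l x).drop i)
      have := sz_pos ((l x).take i)
      omega
    omega
  · rw [hit] at h ⊢
    have hi : i < (l x).length := by
      by_contra hi
      exact h (List.drop_eq_nil_of_le (by omega))
    have := hB x ((l x).take i) (l x)[i] (by
      rw [← List.take_succ_eq_append_getElem hi]; exact List.take_prefix _ _)
    simp only [hBst]
    rw [List.drop_eq_getElem_cons hi]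
    simp only [listUncons, Option.elim]
    omega

theorem foldl' {l : α → List β} {init : α → σ} {step : α → σ → β → σ}
    (hl : PT B l) (hi : PT B init)
    (hs : PT (fun q : α × σ × β => B q.1) fun q => step q.1 q.2.1 q.2.2)
    {T : α → ℕ} (hT : PB B T)
    (hsz : ∀ x m, m <+: l x → WhileLang.sz (m.foldl (step x) (init x)) ≤ T x) :
    PT B fun x => (l x).foldl (step x) (init x) :=
  foldl hl hi hs (hT.add .self) (fun x m h => (hsz x m h).trans (Nat.le_add_right _ _))
    fun x _ _ _ => Nat.le_add_left (B x) (T x)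

@[fun_prop]
theorem reverse {l : α → List β} (hl : PT B l) : PT B fun x => (l x).reverse := by
  have h : ∀ m : List β, m.foldl (fun acc b => b :: acc) [] = m.reverse := fun m => by simp
  refine (foldl' hl (.const []) (step := fun _ acc b => b :: acc)
    (T := fun x => WhileLang.sz (l x)) (by fun_prop) (by fun_prop) fun x m hm => ?_).congr
      fun x => (h _).symm
  rw [h, sz_reverse]; exact sz_le_of_prefix hm

@[fun_prop]
theorem append {l m : α → List β} (hl : PT B l) (hm : PT B m) : PT B fun x => l x ++ m x := by
  have h : ∀ (k n : List β), k.foldl (fun acc b => b :: acc) n = k.reverse ++ n := by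
    intro k; induction k with
    | nil => simp
    | cons b k ih => intro n; simp
  refine (foldl' hl.reverse hm (step := fun _ acc b => b :: acc)
    (T := fun x => WhileLang.sz (l x) + WhileLang.sz (m x)) (by fun_prop) (by fun_prop)
    fun x k hk => ?_).congr fun x => by rw [h, List.reverse_reverse]
  rw [h]
  have := sz_le_of_prefix hk
  rw [sz_reverse] at this
  have := sz_append k.reverse (m x)
  rw [sz_reverse] at this
  omega

/-- The accumulated output is bounded by the number of elements times a common polynomial bound for
the pieces, so the fold over appends stays polynomial. -/
theorem flatMap {l : α → List β} {h : α → β → List γ} {B' : α × β → ℕ} (hl : PT B l)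
    (hh : PT B' fun q => h q.1 q.2) {T : α → ℕ} (hT : PB B T)
    (hB : ∀ x, ∀ b ∈ l x, B' (x, b) ≤ T x) : PT B fun x => (l x).flatMap (h x) := by
  have e : ∀ (x : α) (m : List β), m.foldl (fun acc b => acc ++ h x b) [] = m.flatMap (h x) := by
    intro x m
    induction m using List.reverseRecOn with
    | nil => rfl
    | append_singleton m b ih => simp [ih]
  obtain ⟨k, hk⟩ := hh.2
  have key : ∀ x m, m <+: l x → WhileLang.sz (m.flatMap (h x)) ≤
      WhileLang.sz (l x) * (T x + WhileLang.sz x + WhileLang.sz (l x) + 2) ^ k + 1 := by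
    intro x m hm
    have hlen : m.length ≤ WhileLang.sz (l x) := hm.length_le.trans (length_lt_sz _).le
    refine le_trans ?_ (Nat.add_le_add_right (Nat.mul_le_mul_right _ hlen) 1)
    have hsub : ∀ b ∈ m, b ∈ l x := fun b hb => hm.subset hb
    clear hm hlen
    induction m with
    | nil => simp [sz_nil]
    | cons b m ih =>
      have h1 := ih fun b hb => hsub b (List.mem_cons_of_mem _ hb)
      have h2 := sz_append (h x b) (m.flatMap (h x))
      have hb := hsub b List.mem_cons_self
      have h3 : WhileLang.sz (h x b) ≤ _ := hk (x, b)
      have h4 := hB x b hb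
      have h5 := sz_lt_of_mem hb
      have h6 := sz_mk x b
      have h7 := h3.trans (Nat.pow_le_pow_left (m := T x + WhileLang.sz x + WhileLang.sz (l x) + 2)
        (by omega) k)
      rw [List.flatMap_cons, List.length_cons, Nat.succ_mul]
      omega
  refine (foldl hl (.const []) (step := fun x acc b => acc ++ h x b)
    (B' := fun q => B' (q.1, q.2.2)) (T := fun x => T x + (WhileLang.sz (l x) *
      (T x + WhileLang.sz x + WhileLang.sz (l x) + 2) ^ k + 1)) ?_ (by fun_prop) ?_ ?_).congr
      fun x => (e x _).symm
  · exact append (by fun_prop)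
      (hh.comp (f := fun q : α × List γ × β => (q.1, q.2.2)) (by fun_prop) .self)
  · intro x m hm
    rw [e]; exact (key x m hm).trans (Nat.le_add_left _ _)
  · intro x m b hm
    exact (hB x b (hm.subset (by simp))).trans (Nat.le_add_right _ _)

theorem map {l : α → List β} {h : α → β → γ} {B' : α × β → ℕ} (hl : PT B l)
    (hh : PT B' fun q => h q.1 q.2) {T : α → ℕ} (hT : PB B T)
    (hB : ∀ x, ∀ b ∈ l x, B' (x, b) ≤ T x) : PT B fun x => (l x).map (h x) :=
  (flatMap hl (h := fun x b => [h x b]) (hh.cons (.const [])) hT hB).congr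
    fun x => by rw [List.map_eq_flatMap]

theorem filter {l : α → List β} {h : α → β → Bool} {B' : α × β → ℕ} (hl : PT B l)
    (hh : PT B' fun q => h q.1 q.2) {T : α → ℕ} (hT : PB B T)
    (hB : ∀ x, ∀ b ∈ l x, B' (x, b) ≤ T x) : PT B fun x => (l x).filter (h x) :=
  (flatMap hl (h := fun x b => if h x b then [b] else [])
    (hh.ite (by fun_prop) (.const [])) hT hB).congr fun x => by
      induction l x with
      | nil => rfl
      | cons b m ih =>
        rw [List.flatMap_cons, ← ih, List.filter_cons]
        split <;> simp

@[fun_prop]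
theorem flatMap' {l : α → List β} {h : α → β → List γ} (hl : PT B l)
    (hh : PT (fun q : α × β => B q.1) fun q => h q.1 q.2) :
    PT B fun x => (l x).flatMap (h x) :=
  flatMap hl hh .self fun _ _ _ => le_rfl

@[fun_prop]
theorem map' {l : α → List β} {h : α → β → γ} (hl : PT B l)
    (hh : PT (fun q : α × β => B q.1) fun q => h q.1 q.2) : PT B fun x => (l x).map (h x) :=
  map hl hh .self fun _ _ _ => le_rfl

@[fun_prop]
theorem filter' {l : α → List β} {h : α → β → Bool} (hl : PT B l)
    (hh : PT (fun q : α × β => B q.1) fun q => h q.1 q.2) : PT B fun x => (l x).filter (h x) :=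
  filter hl hh .self fun _ _ _ => le_rfl

@[fun_prop]
theorem any {l : α → List β} {h : α → β → Bool} (hl : PT B l)
    (hh : PT (fun q : α × β => B q.1) fun q => h q.1 q.2) : PT B fun x => (l x).any (h x) :=
  (filter' hl hh).isEmpty.not.congr fun x => by
    rw [Bool.eq_iff_iff]; simp

@[fun_prop]
theorem all {l : α → List β} {h : α → β → Bool} (hl : PT B l)
    (hh : PT (fun q : α × β => B q.1) fun q => h q.1 q.2) : PT B fun x => (l x).all (h x) :=
  (any hl (h := fun x b => !h x b) hh.not).not.congr fun x => by
    rw [Bool.eq_iff_iff]; simp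

/-! ### Pairs of lists -/

@[fun_prop]
theorem zip {l : α → List β} {m : α → List γ} (hl : PT B l) (hm : PT B m) :
    PT B fun x => (l x).zip (m x) := by
  -- The state is the unread rest of the second list and the pairs found so far, in reverse order.
  set st : List γ × List (β × γ) → β → List γ × List (β × γ) := fun u b =>
    (listUncons u.1).elim u fun q => (q.2, (b, q.1) :: u.2) with hst
  have h : ∀ (k : List β) (n : List γ) (acc : List (β × γ)),
      k.foldl st (n, acc) = (n.drop k.length, (k.zip n).reverse ++ acc) := by
    intro k
    induction k with
    | nil => simp
    | cons b k ih =>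
      intro n acc
      cases n with
      | nil => rw [List.foldl_cons, show st ([], acc) b = ([], acc) from rfl, ih]; simp
      | cons c n =>
        rw [List.foldl_cons, show st (c :: n, acc) b = (n, (b, c) :: acc) from rfl, ih]; simp
  refine ((foldl' hl (init := fun x => (m x, [])) (by fun_prop) (step := fun _ => st)
    (T := fun x => WhileLang.sz (m x) + WhileLang.sz (l x) + WhileLang.sz (m x) + 1)
    (by fun_prop) (by fun_prop) fun x k hk => ?_).snd.reverse).congr fun x => by simp [h]
  rw [h, List.append_nil, sz_mk, sz_reverse]
  have h2 : WhileLang.sz ((m x).drop k.length) ≤ WhileLang.sz (m x) := by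
    conv_rhs => rw [← List.take_append_drop k.length (m x)]
    have := sz_append ((m x).take k.length) ((m x).drop k.length)
    have := sz_pos ((m x).take k.length)
    omega
  have := sz_zip_le k (m x)
  have := sz_le_of_prefix hk
  omega

/-! ### Arithmetic -/

@[fun_prop]
theorem succ {n : α → ℕ} (hn : PT B n) : PT B fun x => n x + 1 :=
  ((const ()).prodMk hn).recode fun _ => rfl

/-- A unary number is literally a list of dummies, so recursion on numbers reduces to a fold over a
list. -/
theorem enc_replicate (n : ℕ) : enc (List.replicate n ()) = enc n := by
  induction n with
  | zero => rfl
  | succ n ih => rw [List.replicate_succ, enc_cons, ih]; rfl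

@[fun_prop]
theorem pred {n : α → ℕ} (hn : PT B n) : PT B fun x => n x - 1 :=
  (hn.natElim (.const 0) (g := fun _ q => q.2) (by fun_prop)).congr fun x => by cases n x <;> rfl

@[fun_prop]
theorem range {n : α → ℕ} (hn : PT B n) : PT B fun x => List.range (n x) := by
  have h : ∀ (m : List Unit) (i : ℕ) (acc : List ℕ),
      m.foldl (fun (u : ℕ × List ℕ) _ => (u.1 + 1, u.1 :: u.2)) (i, acc) =
        (i + m.length, (List.range' i m.length).reverse ++ acc) := by
    intro m
    induction m with
    | nil => simp
    | cons b m ih =>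
      intro i acc
      rw [List.foldl_cons, ih, List.length_cons, List.range'_succ]
      simp; omega
  refine ((foldl' (l := fun x => List.replicate (n x) ()) (hn.recode fun x => enc_replicate _)
    (init := fun _ => ((0 : ℕ), ([] : List ℕ))) (step := fun _ u _ => (u.1 + 1, u.1 :: u.2))
    (.const _) (by fun_prop) (T := fun x => WhileLang.sz (n x) +
      (WhileLang.sz (n x) * (WhileLang.sz (n x) + 1) + 1) + 1) (by fun_prop)
      fun x m hm => ?_).snd.reverse).congr fun x => by
        rw [h]; simp [List.range_eq_range']
  have h1 := hm.length_le
  rw [List.length_replicate] at h1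
  rw [h, List.append_nil, sz_mk, sz_reverse]
  have h2 : WhileLang.sz (List.range' 0 m.length) ≤
      WhileLang.sz (n x) * (WhileLang.sz (n x) + 1) + 1 := by
    refine (sz_le_of_forall (K := WhileLang.sz (n x)) fun a ha => ?_).trans ?_
    · simp only [List.mem_range'_1] at ha
      rw [sz_nat, sz_nat]; omega
    · rw [List.length_range']
      gcongr
      rw [sz_nat]; omega
  have h3 : WhileLang.sz (0 + m.length) ≤ WhileLang.sz (n x) := by
    rw [sz_nat, sz_nat]; omega
  omega

theorem natRec {n : α → ℕ} {init : α → σ} {step : α → ℕ → σ → σ} {B' : α × ℕ × σ → ℕ}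
    (hn : PT B n) (hi : PT B init) (hs : PT B' fun q => step q.1 q.2.1 q.2.2)
    {T : α → ℕ} (hT : PB B T)
    (hsz : ∀ x i, i ≤ n x →
      WhileLang.sz (Nat.rec (motive := fun _ => σ) (init x) (step x) i) ≤ T x)
    (hB : ∀ x i, i < n x → B' (x, i, Nat.rec (motive := fun _ => σ) (init x) (step x) i) ≤ T x) :
    PT B fun x => Nat.rec (motive := fun _ => σ) (init x) (step x) (n x) := by
  have h : ∀ x i, (List.range i).foldl (fun acc j => step x j acc) (init x) =
      Nat.rec (motive := fun _ => σ) (init x) (step x) i := by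
    intro x i
    induction i with
    | zero => rfl
    | succ i ih => simp [List.range_succ, ih]
  have hpre : ∀ (m : List ℕ) k, m <+: List.range k → m = List.range m.length ∧ m.length ≤ k := by
    intro m k hm
    have h1 := hm.length_le
    rw [List.length_range] at h1
    refine ⟨?_, h1⟩
    rw [List.prefix_iff_eq_take] at hm
    rw [hm, List.take_range]; simp [h1]
  refine (foldl hn.range hi (step := fun x acc j => step x j acc)
    (B' := fun q => B' (q.1, q.2.2, q.2.1)) ?_ hT (fun x m hm => ?_) fun x m b hm => ?_).congr
      fun x => (h x _).symm
  · exact hs.comp (f := fun q : α × σ × ℕ => (q.1, q.2.2, q.2.1)) (by fun_prop) .self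
  · obtain ⟨h1, h2⟩ := hpre m _ hm
    rw [h1, h]; exact hsz x _ h2
  · obtain ⟨h1, h2⟩ := hpre _ _ hm
    rw [List.length_append, List.length_singleton] at h1 h2
    rw [List.range_succ] at h1
    obtain ⟨h3, h4⟩ := List.append_inj h1 (by simp)
    obtain rfl : b = m.length := by simpa using h4
    have := hB x m.length h2
    rw [← h, ← h3] at this
    exact this

@[fun_prop]
theorem add {n m : α → ℕ} (hn : PT B n) (hm : PT B m) : PT B fun x => n x + m x := by
  have h : ∀ a b : ℕ, Nat.rec (motive := fun _ => ℕ) a (fun _ r => r + 1) b = a + b := by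
    intro a b; induction b with
    | zero => rfl
    | succ b ih => simp only [ih]; omega
  refine (natRec hm hn (step := fun _ _ r => r + 1) (B' := fun q => B q.1)
    (T := fun x => WhileLang.sz (n x) + WhileLang.sz (m x) + B x) (by fun_prop) (by fun_prop)
    (fun x i hi => ?_) fun x i _ => ?_).congr fun x => (h _ _).symm
  · rw [h]; simp only [sz_nat]; omega
  · dsimp only; omega

@[fun_prop]
theorem sub {n m : α → ℕ} (hn : PT B n) (hm : PT B m) : PT B fun x => n x - m x := by
  have h : ∀ a b : ℕ, Nat.rec (motive := fun _ => ℕ) a (fun _ r => r - 1) b = a - b := by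
    intro a b; induction b with
    | zero => rfl
    | succ b ih => simp only [ih]; omega
  refine (natRec hm hn (step := fun _ _ r => r - 1) (B' := fun q => B q.1)
    (T := fun x => WhileLang.sz (n x) + B x) (by fun_prop) (by fun_prop)
    (fun x i hi => ?_) fun x i _ => ?_).congr fun x => (h _ _).symm
  · rw [h]; simp only [sz_nat]; omega
  · dsimp only; omega

@[fun_prop]
theorem mul {n m : α → ℕ} (hn : PT B n) (hm : PT B m) : PT B fun x => n x * m x := by
  have h : ∀ a b : ℕ, Nat.rec (motive := fun _ => ℕ) 0 (fun _ r => r + a) b = a * b := by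
    intro a b; induction b with
    | zero => rfl
    | succ b ih => simp only [ih]; ring
  refine (natRec hm (.const 0) (step := fun x _ r => r + n x) (B' := fun q => B q.1)
    (T := fun x => WhileLang.sz (n x) * WhileLang.sz (m x) + B x) (add (by fun_prop) hn.comp_fst)
    (by fun_prop) (fun x i hi => ?_) fun x i _ => ?_).congr fun x => (h _ _).symm
  · rw [h]; simp only [sz_nat]; nlinarith [Nat.zero_le (n x)]
  · dsimp only; omega

@[fun_prop]
theorem beqZero {n : α → ℕ} (hn : PT B n) : PT B fun x => decide (n x = 0) :=
  (hn.natElim (.const true) (g := fun _ _ => false) (.const false)).congr fun x => by cases n x <;> simp [natUncons]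

@[fun_prop]
theorem le {n m : α → ℕ} (hn : PT B n) (hm : PT B m) : PT B fun x => decide (n x ≤ m x) :=
  (hn.sub hm).beqZero.congr fun x => by simp [Nat.sub_eq_zero_iff_le]

@[fun_prop]
theorem lt {n m : α → ℕ} (hn : PT B n) (hm : PT B m) : PT B fun x => decide (n x < m x) :=
  (hn.succ.le hm).congr fun x => by simp

/-! ### Equality -/

/-- One step of the comparison of two trees: `W` lists the pairs still to be compared. -/
def eqStep (u : List (Val × Val) × Bool) : List (Val × Val) × Bool :=
  (listUncons u.1).elim u fun q =>
    q.1.1.uncons.elim (q.1.2.uncons.elim (q.2, u.2) fun _ => ([], false)) fun a =>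
      q.1.2.uncons.elim ([], false) fun b => ((a.1, b.1) :: (a.2, b.2) :: q.2, u.2)

theorem eqStep_nil (r : Bool) : eqStep ([], r) = ([], r) := rfl

/-- The loop invariant of the comparison: a mismatch clears the list and sets the verdict to false,
and any other step splits or drops a pair without changing the truth of the conjunction. -/
theorem eqStep_correct (u : List (Val × Val) × Bool) :
    ((eqStep u).2 = true ∧ ∀ p ∈ (eqStep u).1, p.1 = p.2) ↔ (u.2 = true ∧ ∀ p ∈ u.1, p.1 = p.2) := by
  obtain ⟨_ | ⟨⟨a, b⟩, W⟩, r⟩ := u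
  · rfl
  · cases a <;> cases b <;> simp [eqStep, listUncons, Val.uncons, and_assoc]

/-- The termination measure: every step consumes a node of the left components, so as many steps as
the left tree has nodes empty the list. -/
theorem eqStep_left_size (u : List (Val × Val) × Bool) :
    ((eqStep u).1.map fun p => p.1.size).sum ≤ (u.1.map fun p => p.1.size).sum - 1 := by
  obtain ⟨_ | ⟨⟨a, b⟩, W⟩, r⟩ := u
  · rfl
  · cases a <;> cases b <;> (simp [eqStep, listUncons, Val.uncons, Val.size]; try omega)

theorem eqStep_size (u : List (Val × Val) × Bool) :
    ((eqStep u).1.map fun p => p.1.size + p.2.size).sum ≤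
      (u.1.map fun p => p.1.size + p.2.size).sum := by
  obtain ⟨_ | ⟨⟨a, b⟩, W⟩, r⟩ := u
  · rfl
  · cases a <;> cases b <;> (simp [eqStep, listUncons, Val.uncons, Val.size]; try omega)

theorem eqStep_iterate (a b : Val) (i : ℕ) :
    (((eqStep^[i] ([(a, b)], true)).2 = true ∧ ∀ p ∈ (eqStep^[i] ([(a, b)], true)).1, p.1 = p.2) ↔
      a = b) ∧
    ((eqStep^[i] ([(a, b)], true)).1.map fun p => p.1.size).sum ≤ a.size - i ∧
    ((eqStep^[i] ([(a, b)], true)).1.map fun p => p.1.size + p.2.size).sum ≤ a.size + b.size := by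
  induction i with
  | zero => simp
  | succ i ih =>
    rw [Function.iterate_succ_apply']
    refine ⟨(eqStep_correct _).trans ih.1, ?_, (eqStep_size _).trans ih.2.2⟩
    have := eqStep_left_size (eqStep^[i] ([(a, b)], true))
    omega

theorem sz_pairs_le (W : List (Val × Val)) :
    WhileLang.sz W ≤ 2 * (W.map fun p => p.1.size + p.2.size).sum + 1 := by
  induction W with
  | nil => simp [sz_nil]
  | cons p W ih =>
    have : WhileLang.sz p = p.1.size + p.2.size + 1 := rfl
    have := p.1.size_pos
    have := p.2.size_pos
    rw [sz_cons, List.map_cons, List.sum_cons]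
    omega

theorem valEq [DecidableEq Val] {f g : α → Val} (hf : PT B f) (hg : PT B g) :
    PT B fun x => decide (f x = g x) := by
  have hend : ∀ x, (eqStep^[WhileLang.sz (f x)] ([(f x, g x)], true)).1 = [] := by
    intro x
    have := (eqStep_iterate (f x) (g x) (WhileLang.sz (f x))).2.1
    rcases h : (eqStep^[WhileLang.sz (f x)] ([(f x, g x)], true)).1 with _ | ⟨p, W⟩
    · rfl
    · rw [h, List.map_cons, List.sum_cons] at this
      have := p.1.size_pos
      have : WhileLang.sz (f x) = (f x).size := rfl
      omega
  have hstep : PT (fun _ => 0) eqStep := by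
    unfold eqStep
    fun_prop
  refine (loop (B := B) (init := fun x => ([(f x, g x)], true)) (by fun_prop) hstep eqStep_nil
    (N := fun x => WhileLang.sz (f x))
    (T := fun x => 2 * (WhileLang.sz (f x) + WhileLang.sz (g x)) + 5) (by fun_prop) (by fun_prop)
    hend (fun x i _ => ?_) (fun _ _ _ _ => Nat.zero_le _)).congr fun x => ?_
  · have h1 := (eqStep_iterate (f x) (g x) i).2.2
    have h2 := sz_pairs_le (eqStep^[i] ([(f x, g x)], true)).1
    have h3 := sz_prod (eqStep^[i] ([(f x, g x)], true))
    have h4 := sz_bool (eqStep^[i] ([(f x, g x)], true)).2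
    have : WhileLang.sz (f x) = (f x).size := rfl
    have : WhileLang.sz (g x) = (g x).size := rfl
    omega
  · have := (eqStep_iterate (f x) (g x) (WhileLang.sz (f x))).1
    rw [hend] at this
    rw [Bool.eq_iff_iff]
    simpa using this.symm

end PT

/-- Types whose elements are determined by their encodings. -/
class InjEnc (α : Type) [Enc α] : Prop where
  inj : Function.Injective (enc : α → Val)

instance : InjEnc ℕ := ⟨enc_injective_nat⟩
instance : InjEnc Bool := ⟨enc_injective_bool⟩
instance [InjEnc α] : InjEnc (List α) := ⟨enc_injective_list InjEnc.inj⟩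
instance [InjEnc α] [InjEnc β] : InjEnc (α × β) := ⟨enc_injective_prod InjEnc.inj InjEnc.inj⟩

namespace PT

variable {B : α → ℕ}

@[fun_prop]
theorem decideEq [DecidableEq β] [InjEnc β] {f g : α → β} (hf : PT B f) (hg : PT B g) :
    PT B fun x => decide (f x = g x) := by
  classical
  refine (valEq (f := fun x => enc (f x)) (g := fun x => enc (g x)) (hf.recode fun _ => rfl)
    (hg.recode fun _ => rfl)).congr fun x => ?_
  rw [decide_eq_decide]
  exact InjEnc.inj.eq_iff.symm

@[fun_prop]
theorem decideMem [InjEnc β] {f : α → β} {l : α → List β} [∀ x, Decidable (f x ∈ l x)]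
    (hf : PT B f) (hl : PT B l) : PT B fun x => decide (f x ∈ l x) := by
  classical
  exact (any hl (h := fun x b => decide (f x = b)) (hf.comp_fst.decideEq (by fun_prop))).congr
    fun x => by rw [Bool.eq_iff_iff]; simp

@[fun_prop]
theorem iteEq [DecidableEq β] [InjEnc β] {f g : α → β} {u v : α → σ} (hf : PT B f) (hg : PT B g)
    (hu : PT B u) (hv : PT B v) : PT B fun x => if f x = g x then u x else v x :=
  ((hf.decideEq hg).ite hu hv).congr fun x => by simp

@[fun_prop]
theorem iteLe {f g : α → ℕ} {u v : α → σ} (hf : PT B f) (hg : PT B g)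
    (hu : PT B u) (hv : PT B v) : PT B fun x => if f x ≤ g x then u x else v x :=
  ((hf.le hg).ite hu hv).congr fun x => by simp

@[fun_prop]
theorem iteLt {f g : α → ℕ} {u v : α → σ} (hf : PT B f) (hg : PT B g)
    (hu : PT B u) (hv : PT B v) : PT B fun x => if f x < g x then u x else v x :=
  ((hf.lt hg).ite hu hv).congr fun x => by simp

@[fun_prop]
theorem mod {n m : α → ℕ} (hn : PT B n) (hm : PT B m) : PT B fun x => n x % m x := by
  -- A counter that is reset on reaching `b`. For `b = 0` it is never reset, in accordance with `a %
  -- 0 = a`.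
  have h : ∀ a b : ℕ, Nat.rec (motive := fun _ => ℕ) 0
      (fun _ r => if r + 1 = b then 0 else r + 1) a = a % b := by
    intro a b; induction a with
    | zero => simp
    | succ a ih =>
      simp only [ih]
      rcases b with _ | b
      · simp
      · have h1 : a % (b + 1) < b + 1 := Nat.mod_lt a (Nat.succ_pos b)
        conv_rhs => rw [← Nat.div_add_mod a (b + 1), add_assoc, Nat.mul_add_mod]
        split_ifs with h
        · rw [h, Nat.mod_self]
        · exact (Nat.mod_eq_of_lt (by omega)).symm
  refine (natRec hn (.const 0) (step := fun x _ r => if r + 1 = m x then 0 else r + 1)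
    (B' := fun q => B q.1)
    (T := fun x => WhileLang.sz (n x) + B x)
    (iteEq (by fun_prop) hm.comp_fst (by fun_prop) (by fun_prop)) (by fun_prop)
    (fun x i hi => ?_) fun x i _ => ?_).congr fun x => (h _ _).symm
  · rw [h]; simp only [sz_nat]; have := Nat.mod_le i (m x); omega
  · dsimp only; omega

end PT
end WhileLang

open WhileLang

/-! ## Instances of the CSP as plain data -/

/-- A constraint as plain data: the scope and the list of tuples. -/
abbrev RawConstraint : Type := List ℕ × List (List ℕ)

/-- An instance as plain data: the numbers of variables and of values, and the constraints. -/
abbrev RawCSP : Type := ℕ × ℕ × List RawConstraint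

def CSPConstraint.raw {n d : ℕ} (C : CSPConstraint n d) : RawConstraint :=
  (C.scope.map Fin.val, C.tuples.map fun r => r.map Fin.val)

namespace CSPInstance

def raw (I : CSPInstance) : RawCSP := (I.n, I.d, I.constraints.map CSPConstraint.raw)

/-- Dropping the proofs and the bounds in `Fin` does not alter the encoding, so a program for the
plain data is a program for instances. -/
theorem enc_raw (I : CSPInstance) : Enc.enc I.raw = I.code := by
  simp only [Enc.enc, raw, CSPConstraint.raw, code, List.map_map, Function.comp_def,
    bind_pure_comp, List.map_eq_map]

end CSPInstance

namespace RawCSP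

/-- The assignment `τ` satisfies all constraints. -/
def Consistent (x : RawCSP) : Prop :=
  ∃ τ : ℕ → ℕ, (∀ v < x.1, τ v < x.2.1) ∧ ∀ C ∈ x.2.2, C.1.map τ ∈ C.2

end RawCSP

theorem CSPInstance.consistent_raw (I : CSPInstance) : I.raw.Consistent ↔ I.Consistent := by
  have hinj : Function.Injective fun r : List (Fin I.d) => r.map Fin.val :=
    List.map_injective_iff.2 Fin.val_injective
  have key : ∀ (τ : Fin I.n → Fin I.d) (τ' : ℕ → ℕ), (∀ v, τ' v.val = (τ v).val) →
      ∀ C ∈ I.constraints, (C.SatisfiedBy τ ↔ C.raw.1.map τ' ∈ C.raw.2) := by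
    intro τ τ' h C _
    have : C.raw.1.map τ' = (C.scope.map τ).map Fin.val := by
      simp [CSPConstraint.raw, h]
    rw [this, CSPConstraint.SatisfiedBy, CSPConstraint.raw]
    exact (List.mem_map_of_injective hinj).symm
  constructor
  · rintro ⟨τ', h1, h2⟩
    refine ⟨fun v => ⟨τ' v, h1 v v.2⟩, fun C hC => (key _ τ' (fun _ => rfl) C hC).2 ?_⟩
    exact h2 _ (List.mem_map_of_mem hC)
  · rintro ⟨τ, h⟩
    refine ⟨fun v => if hv : v < I.n then τ ⟨v, hv⟩ else 0, fun v hv => ?_, fun C hC => ?_⟩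
    · have hv' : v < I.n := hv
      simp only [hv', dif_pos]; exact (τ _).2
    · obtain ⟨C, hC', rfl⟩ := List.mem_map.1 hC
      exact (key τ _ (fun v => by simp) C hC').1 (h C hC')

/-! ## Joining constraints -/

namespace RawCSP

/-- A list of pairs in which no first component has two different second components. -/
def functional (l : List (ℕ × ℕ)) : Bool :=
  l.all fun p => l.all fun q => !decide (p.1 = q.1) || decide (p.2 = q.2)

theorem functional_iff {l : List (ℕ × ℕ)} :
    functional l = true ↔ ∀ p ∈ l, ∀ q ∈ l, p.1 = q.1 → p.2 = q.2 := by
  simp only [functional, List.all_eq_true, Bool.or_eq_true, Bool.not_eq_true', decide_eq_true_eq,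
    decide_eq_false_iff_not, imp_iff_not_or]

/-- All extensions of the partial assignments in `L` by tuples of the constraint `C`. -/
def joinStep (L : List (List (ℕ × ℕ))) (C : RawConstraint) : List (List (ℕ × ℕ)) :=
  L.flatMap fun a => (C.2.map fun r => C.1.zip r ++ a).filter functional

/-- The join of a list of constraints. -/
def join (cs : List RawConstraint) : List (List (ℕ × ℕ)) := cs.foldl joinStep [[]]

/-- Decides an instance by joining all its constraints. -/
def solve (x : RawCSP) : Bool :=
  (decide (x.1 = 0) || !decide (x.2.1 = 0)) && !(join x.2.2).isEmpty

theorem mem_joinStep {L : List (List (ℕ × ℕ))} {C : RawConstraint} {b : List (ℕ × ℕ)} :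
    b ∈ joinStep L C ↔ ∃ a ∈ L, ∃ r ∈ C.2, C.1.zip r ++ a = b ∧ functional b = true := by
  simp only [joinStep, List.mem_flatMap, List.mem_filter, List.mem_map]
  constructor
  · rintro ⟨a, ha, ⟨r, hr, e⟩, h⟩; exact ⟨a, ha, r, hr, e, h⟩
  · rintro ⟨a, ha, r, hr, e, h⟩; exact ⟨a, ha, ⟨r, hr, e⟩, h⟩

theorem join_concat (cs : List RawConstraint) (C : RawConstraint) :
    join (cs ++ [C]) = joinStep (join cs) C := by simp [join]

/-- Soundness invariant of the join. The last clause is what later shows that assigned values belong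
to the domain. -/
theorem of_mem_join {cs : List RawConstraint} {a : List (ℕ × ℕ)} (h : a ∈ join cs) :
    functional a = true ∧ (∀ C ∈ cs, ∃ r ∈ C.2, C.1.zip r ⊆ a) ∧
      ∀ p ∈ a, ∃ C ∈ cs, ∃ r ∈ C.2, p.2 ∈ r := by
  induction cs using List.reverseRecOn generalizing a with
  | nil =>
    obtain rfl : a = [] := by simpa [join] using h
    simp [functional]
  | append_singleton cs C ih =>
    rw [join_concat, mem_joinStep] at h
    obtain ⟨a, ha, r, hr, rfl, hf⟩ := h
    obtain ⟨-, h2, h3⟩ := ih ha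
    refine ⟨hf, fun C' hC' => ?_, fun p hp => ?_⟩
    · rcases List.mem_append.1 hC' with hC' | hC'
      · obtain ⟨r', hr', hs⟩ := h2 C' hC'
        exact ⟨r', hr', fun p hp => List.mem_append_right _ (hs hp)⟩
      · obtain rfl : C' = C := by simpa using hC'
        exact ⟨r, hr, List.subset_append_left _ _⟩
    · rcases List.mem_append.1 hp with hp | hp
      · exact ⟨C, by simp, r, hr, (List.of_mem_zip (a := p.1) (b := p.2) hp).2⟩
      · obtain ⟨C', hC', h⟩ := h3 p hp
        exact ⟨C', List.mem_append_left _ hC', h⟩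

theorem zip_map_self {τ : ℕ → ℕ} {S : List ℕ} {p : ℕ × ℕ} (h : p ∈ S.zip (S.map τ)) :
    p.2 = τ p.1 := by
  induction S with
  | nil => simp at h
  | cons v S ih =>
    rcases List.mem_cons.1 h with rfl | h
    · rfl
    · exact ih h

theorem map_eq_of_zip {τ : ℕ → ℕ} {S r : List ℕ} (hlen : r.length = S.length)
    (h : ∀ p ∈ S.zip r, p.2 = τ p.1) : S.map τ = r := by
  induction S generalizing r with
  | nil => simpa [eq_comm] using hlen
  | cons v S ih =>
    cases r with
    | nil => simp at hlen
    | cons w r =>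
      rw [List.map_cons, ih (by simpa using hlen) fun p hp => h p (List.mem_cons_of_mem _ hp),
        ← show w = τ v from h (v, w) List.mem_cons_self]

/-- Completeness: the restrictions of a solution to the scopes are pairwise compatible, so they
survive every filter. -/
theorem exists_mem_join {cs : List RawConstraint} {τ : ℕ → ℕ} (h : ∀ C ∈ cs, C.1.map τ ∈ C.2) :
    ∃ a ∈ join cs, ∀ p ∈ a, p.2 = τ p.1 := by
  induction cs using List.reverseRecOn with
  | nil => exact ⟨[], by simp [join], by simp⟩
  | append_singleton cs C ih =>
    obtain ⟨a, ha, hp⟩ := ih fun C' hC' => h C' (List.mem_append_left _ hC')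
    have hb : ∀ p ∈ C.1.zip (C.1.map τ) ++ a, p.2 = τ p.1 := fun p h =>
      (List.mem_append.1 h).elim zip_map_self (hp p)
    refine ⟨_, ?_, hb⟩
    rw [join_concat, mem_joinStep]
    exact ⟨a, ha, _, h C (by simp), rfl,
      functional_iff.2 fun p hp q hq e => by rw [hb p hp, hb q hq, e]⟩

/-- The join ignores variables outside all scopes. These can be given a value iff the domain is
non-empty, which explains the test on the numbers of variables and values in `solve`. -/
theorem solve_iff {x : RawCSP} (hlen : ∀ C ∈ x.2.2, ∀ r ∈ C.2, r.length = C.1.length)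
    (hval : ∀ C ∈ x.2.2, ∀ r ∈ C.2, ∀ w ∈ r, w < x.2.1) : solve x = true ↔ x.Consistent := by
  have hs : solve x = true ↔ (x.1 = 0 ∨ x.2.1 ≠ 0) ∧ join x.2.2 ≠ [] := by
    simp [solve]
  rw [hs]
  constructor
  · rintro ⟨h0, h⟩
    obtain ⟨a, ha⟩ := List.exists_mem_of_ne_nil _ h
    obtain ⟨h1, h2, h3⟩ := of_mem_join ha
    rw [functional_iff] at h1
    classical
    -- Unassigned variables receive `0`, which is in the domain as soon as there is a variable.
    set τ : ℕ → ℕ := fun v => if h : ∃ w, (v, w) ∈ a then h.choose else 0 with hτ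
    have hτa : ∀ p ∈ a, p.2 = τ p.1 := by
      intro p hp
      have hex : ∃ w, (p.1, w) ∈ a := ⟨p.2, hp⟩
      simp only [hτ, dif_pos hex]
      exact h1 p hp _ hex.choose_spec rfl
    refine ⟨τ, fun v hv => ?_, fun C hC => ?_⟩
    · by_cases hex : ∃ w, (v, w) ∈ a
      · obtain ⟨w, hw⟩ := hex
        obtain ⟨C, hC, r, hr, hm⟩ := h3 _ hw
        rw [← hτa _ hw]; exact hval C hC r hr _ hm
      · simp only [hτ, dif_neg hex]; omega
    · obtain ⟨r, hr, hsub⟩ := h2 C hC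
      rw [map_eq_of_zip (hlen C hC r hr) fun p hp => hτa p (hsub hp)]
      exact hr
  · rintro ⟨τ, h1, h2⟩
    refine ⟨?_, ?_⟩
    · by_contra! h
      have := h1 0 (by omega)
      omega
    · obtain ⟨a, ha, -⟩ := exists_mem_join h2
      exact List.ne_nil_of_mem ha

theorem length_join_le {cs : List RawConstraint} {M : ℕ} (h : ∀ C ∈ cs, C.2.length ≤ M) :
    (join cs).length ≤ M ^ cs.length := by
  induction cs using List.reverseRecOn with
  | nil => simp [join]
  | append_singleton cs C ih =>
    have ih := ih fun C' hC' => h C' (List.mem_append_left _ hC')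
    have hC := h C (by simp)
    have : ∀ L, (joinStep L C).length ≤ L.length * M := by
      intro L
      induction L with
      | nil => simp [joinStep]
      | cons a L ihL =>
        have h1 := List.length_filter_le functional (C.2.map fun r => C.1.zip r ++ a)
        rw [List.length_map] at h1
        have h2 : (joinStep (a :: L) C).length = ((C.2.map fun r => C.1.zip r ++ a).filter
          functional).length + (joinStep L C).length := by simp [joinStep]
        rw [h2, List.length_cons, Nat.succ_mul]; omega
    rw [join_concat, List.length_append, List.length_singleton, pow_succ]
    exact (this _).trans (Nat.mul_le_mul_right _ ih)

theorem sz_le_of_mem_join {cs : List RawConstraint} {a : List (ℕ × ℕ)} (h : a ∈ join cs) :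
    sz a ≤ sz cs := by
  induction cs using List.reverseRecOn generalizing a with
  | nil =>
    obtain rfl : a = [] := by simpa [join] using h
    simp [sz_nil]
  | append_singleton cs C ih =>
    rw [join_concat, mem_joinStep] at h
    obtain ⟨a, ha, r, hr, rfl, -⟩ := h
    have h1 := ih ha
    have h2 := sz_append (C.1.zip r) a
    have h3 := sz_append cs [C]
    have h4 := sz_zip_le C.1 r
    have h5 := sz_lt_of_mem hr
    have h6 := sz_prod C
    rw [sz_cons, sz_nil] at h3
    omega

/-- The size of the instance to the power of the number of constraints. -/
def joinBound (x : RawCSP) : ℕ := sz x ^ x.2.2.length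

theorem sz_join_prefix_le (x : RawCSP) {m : List RawConstraint} (hm : m <+: x.2.2) :
    sz (join m) ≤ joinBound x * (sz x + 1) + 1 := by
  have hx := sz_prod x
  have hx' := sz_prod x.2
  have h1 := sz_le_of_prefix hm
  refine (sz_le_of_forall (K := sz x) fun a ha => ?_).trans ?_
  · have := sz_le_of_mem_join ha
    omega
  · refine Nat.add_le_add_right (Nat.mul_le_mul_right _ ?_) 1
    refine (length_join_le (M := sz x) fun C hC => ?_).trans
      (Nat.pow_le_pow_right (sz_pos x) hm.length_le)
    have h2 := sz_lt_of_mem hC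
    have h3 := length_lt_sz C.2
    have h4 := sz_prod C
    omega

/-- All operations are polynomial in the current list of partial assignments; the number of
constraints enters only through the exponent in `joinBound`. -/
theorem solve_PT : PT joinBound solve := by
  have hf : PT (fun _ => 0) functional := by
    unfold functional
    fun_prop
  have hj : PT joinBound fun x : RawCSP => join x.2.2 := by
    refine PT.foldl' (l := fun x : RawCSP => x.2.2) (init := fun _ => [[]])
      (step := fun _ => joinStep) (by fun_prop) (by fun_prop) ?_
      (T := fun x => joinBound x * (sz x + 1) + 1) (by fun_prop)
      fun x m hm => sz_join_prefix_le x hm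
    unfold joinStep
    fun_prop
  unfold solve
  fun_prop

end RawCSP

/-! ### Polynomial time for boundedly many constraints -/

theorem CSPInstance.polyTime_of_cons_le (c : ℕ) : CSPInstance.PolyTime {I | I.cons ≤ c} := by
  obtain ⟨⟨p, T, ⟨e, hT⟩, hp⟩, -⟩ := RawCSP.solve_PT
  -- With `z` the size and `m ≤ c` constraints, `z ^ m + z + 1 ≤ 3 * z ^ (c + 1)`; the exponent `c +
  -- 1` takes care of the summand `z` when `c = 0`.
  refine ⟨p, 3 ^ e, (c + 1) * e, fun I hI => ?_⟩
  obtain ⟨s, t, h1, h2, h3⟩ := hp I.raw (initStore I.code) (by simp [initStore, enc_raw])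
  refine ⟨s, t, h1, h2.trans ((hT _).trans ?_), ?_⟩
  · have hsz : sz I.raw = I.code.size := by rw [sz, enc_raw]
    have hpos : 1 ≤ I.code.size := I.code.size_pos
    dsimp only
    rw [pow_mul, ← mul_pow, RawCSP.joinBound, hsz]
    refine Nat.pow_le_pow_left ?_ e
    have hc : I.raw.2.2.length ≤ c := by simpa [raw, CSPInstance.cons] using hI
    have h4 : I.code.size ^ I.raw.2.2.length ≤ I.code.size ^ (c + 1) :=
      Nat.pow_le_pow_right hpos (by omega)
    have h5 : I.code.size ^ 1 ≤ I.code.size ^ (c + 1) := Nat.pow_le_pow_right hpos (by omega)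
    have h6 : 1 ≤ I.code.size ^ (c + 1) := Nat.one_le_pow _ _ hpos
    rw [pow_one] at h5
    omega
  · rw [h3, ← consistent_raw, ← RawCSP.solve_iff]
    · cases RawCSP.solve I.raw <;> simp [Enc.enc, Val.ofBool]
    · intro C hC r hr
      obtain ⟨C, -, rfl⟩ := List.mem_map.1 hC
      obtain ⟨r, hr', rfl⟩ := List.mem_map.1 hr
      simpa [CSPConstraint.raw] using C.length_eq r hr'
    · intro C hC r hr w hw
      obtain ⟨C, -, rfl⟩ := List.mem_map.1 hC
      obtain ⟨r, hr, rfl⟩ := List.mem_map.1 hr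
      obtain ⟨w, -, rfl⟩ := List.mem_map.1 hw
      exact w.2

/-! ### Square roots and the pairing function in polynomial time -/

namespace WhileLang

namespace PT

variable {α : Type} [Enc α] {B : α → ℕ}

@[fun_prop]
theorem nat_sqrt {n : α → ℕ} (hn : PT B n) : PT B fun x => Nat.sqrt (n x) := by
  -- Linear search, affordable because numbers are unary: after `i` rounds the record is `min i
  -- a.sqrt`.
  have h : ∀ a i : ℕ, Nat.rec (motive := fun _ => ℕ) 0
      (fun j r => if (j + 1) * (j + 1) ≤ a then j + 1 else r) i = min i a.sqrt := by
    intro a i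
    induction i with
    | zero => simp
    | succ i ih =>
      simp only [← Nat.le_sqrt] at ih ⊢
      rw [ih]
      split_ifs <;> omega
  refine (natRec hn (.const 0) (step := fun x j r => if (j + 1) * (j + 1) ≤ n x then j + 1 else r)
    (B' := fun q => B q.1) (T := fun x => WhileLang.sz (n x) + B x)
    (iteLe (by fun_prop) hn.comp_fst (by fun_prop) (by fun_prop)) (by fun_prop)
    (fun x i hi => ?_) fun x i _ => ?_).congr fun x => ?_
  · rw [h]; simp only [sz_nat]; omega
  · dsimp only; omega
  · rw [h, min_eq_right (Nat.sqrt_le_self _)]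

@[fun_prop]
theorem nat_pair {n m : α → ℕ} (hn : PT B n) (hm : PT B m) :
    PT B fun x => Nat.pair (n x) (m x) := by
  unfold Nat.pair
  fun_prop

@[fun_prop]
theorem nat_unpair {n : α → ℕ} (hn : PT B n) : PT B fun x => Nat.unpair (n x) := by
  unfold Nat.unpair
  dsimp only
  fun_prop

end PT

/-! ## Bounded evaluation of partial recursive functions -/

open Nat.Partrec (Code)
open Nat.Partrec.Code (evaln evaln_bound)

/-- The value found by evaluating `c` at `n` with fuel `k`, plus one; `0` if there is none. -/
def evalN (c : Code) (k n : ℕ) : ℕ := (evaln k c n).elim 0 (· + 1)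

theorem evalN_eq_succ {c : Code} {k n v : ℕ} : evalN c k n = v + 1 ↔ v ∈ evaln k c n := by
  rw [evalN]; cases evaln k c n <;> simp

theorem evalN_of_le {c : Code} {k n : ℕ} (h : k ≤ n) : evalN c k n = 0 := by
  by_contra h0
  obtain ⟨v, hv⟩ := Nat.exists_eq_succ_of_ne_zero h0
  have := evaln_bound (evalN_eq_succ.1 hv)
  omega

theorem evalN_mono {c : Code} {k k' n : ℕ} (h : k ≤ k') : evalN c k n ≤ evalN c k' n := by
  rcases h0 : evalN c k n with _ | v
  · exact Nat.zero_le _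
  · exact (evalN_eq_succ.2 (Nat.Partrec.Code.evaln_mono h (evalN_eq_succ.1 h0))).ge

theorem evalN_zero (k n : ℕ) : evalN .zero k n = if n < k then 1 else 0 := by
  cases k with
  | zero => simp [evalN, evaln]
  | succ k => by_cases h : n ≤ k <;> simp [evalN, evaln, h]

theorem evalN_succ (k n : ℕ) : evalN .succ k n = if n < k then n + 2 else 0 := by
  cases k with
  | zero => simp [evalN, evaln]
  | succ k => by_cases h : n ≤ k <;> simp [evalN, evaln, h]

theorem evalN_left (k n : ℕ) : evalN .left k n = if n < k then n.unpair.1 + 1 else 0 := by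
  cases k with
  | zero => simp [evalN, evaln]
  | succ k => by_cases h : n ≤ k <;> simp [evalN, evaln, h]

theorem evalN_right (k n : ℕ) : evalN .right k n = if n < k then n.unpair.2 + 1 else 0 := by
  cases k with
  | zero => simp [evalN, evaln]
  | succ k => by_cases h : n ≤ k <;> simp [evalN, evaln, h]

theorem evalN_pair (cf cg : Code) (k n : ℕ) : evalN (.pair cf cg) k n =
    if n < k then if evalN cf k n = 0 then 0 else if evalN cg k n = 0 then 0 else
      Nat.pair (evalN cf k n - 1) (evalN cg k n - 1) + 1 else 0 := by
  cases k with
  | zero => simp [evalN, evaln]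
  | succ k =>
    by_cases h : n ≤ k
    · rcases h1 : evaln (k + 1) cf n with _ | u <;> rcases h2 : evaln (k + 1) cg n with _ | v <;>
        simp [evalN, evaln, Seq.seq, h, h1, h2]
    · simp [evalN, evaln, h]

theorem evalN_comp (cf cg : Code) (k n : ℕ) : evalN (.comp cf cg) k n =
    if n < k then if evalN cg k n = 0 then 0 else evalN cf k (evalN cg k n - 1) else 0 := by
  cases k with
  | zero => simp [evalN, evaln]
  | succ k =>
    by_cases h : n ≤ k
    · rcases h1 : evaln (k + 1) cg n with _ | v <;> simp [evalN, evaln, h, h1]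
    · simp [evalN, evaln, h]

theorem evalN_prec_zero (cf cg : Code) (k a : ℕ) : evalN (.prec cf cg) k (Nat.pair a 0) =
    if Nat.pair a 0 < k then evalN cf k a else 0 := by
  cases k with
  | zero => simp [evalN, evaln]
  | succ k =>
    by_cases h : Nat.pair a 0 ≤ k
    · simp [evalN, evaln, h]
    · simp [evalN, evaln, h]

theorem evalN_prec_succ (cf cg : Code) (k a y : ℕ) :
    evalN (.prec cf cg) (k + 1) (Nat.pair a (y + 1)) =
    if Nat.pair a (y + 1) < k + 1 then
      if evalN (.prec cf cg) k (Nat.pair a y) = 0 then 0 else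
        evalN cg (k + 1) (Nat.pair a (Nat.pair y (evalN (.prec cf cg) k (Nat.pair a y) - 1)))
    else 0 := by
  by_cases h : Nat.pair a (y + 1) ≤ k
  · rcases h1 : evaln k (.prec cf cg) (Nat.pair a y) with _ | v <;> simp [evalN, evaln, h, h1]
  · simp [evalN, evaln, h]

theorem evalN_rfind (cf : Code) (k a m : ℕ) :
    evalN (.rfind' cf) k (Nat.pair a m) =
    if Nat.pair a m < k then
      if evalN cf k (Nat.pair a m) = 0 then 0
      else if evalN cf k (Nat.pair a m) = 1 then m + 1
      else evalN (.rfind' cf) (k - 1) (Nat.pair a (m + 1))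
    else 0 := by
  cases k with
  | zero => simp [evalN, evaln]
  | succ k =>
    by_cases h : Nat.pair a m ≤ k
    · rcases h1 : evaln (k + 1) cf (Nat.pair a m) with _ | _ | x <;> simp [evalN, evaln, h, h1]
    · simp [evalN, evaln, h]

/-- Evaluation with fuel `k` succeeds only on arguments below `k`, and this is checked again at
every call. Hence intermediate results cannot compound: composition inherits the bound of the outer
code, pairing squares a bound, and the exponent depends on `c` alone. -/
theorem exists_evalN_le (c : Code) : ∃ e, ∀ k n, evalN c k n ≤ (k + 2) ^ e := by
  have h1 : ∀ k e, 1 ≤ (k + 2) ^ e := fun k e => Nat.one_le_pow _ _ (by omega)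
  have hmono : ∀ k e e', e ≤ e' → (k + 2) ^ e ≤ (k + 2) ^ e' := fun k e e' h =>
    Nat.pow_le_pow_right (by omega) h
  induction c with
  | zero => exact ⟨0, fun k n => by rw [evalN_zero]; split_ifs <;> simp⟩
  | succ => exact ⟨1, fun k n => by rw [evalN_succ, pow_one]; split_ifs <;> omega⟩
  | left =>
    refine ⟨1, fun k n => ?_⟩
    have := Nat.unpair_left_le n
    rw [evalN_left, pow_one]; split_ifs <;> omega
  | right =>
    refine ⟨1, fun k n => ?_⟩
    have := Nat.unpair_right_le n
    rw [evalN_right, pow_one]; split_ifs <;> omega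
  | pair cf cg ihf ihg =>
    obtain ⟨e, he⟩ := ihf
    obtain ⟨f, hf⟩ := ihg
    refine ⟨(max e f) * 2 + 1, fun k n => ?_⟩
    rw [evalN_pair]
    split_ifs with h2 h3 h4
    · exact Nat.zero_le _
    · exact Nat.zero_le _
    · have h5 := (he k n).trans (hmono k _ _ (le_max_left e f))
      have h6 := (hf k n).trans (hmono k _ _ (le_max_right e f))
      have h7 := Nat.pair_lt_max_add_one_sq (evalN cf k n - 1) (evalN cg k n - 1)
      have h8 : (max (evalN cf k n - 1) (evalN cg k n - 1) + 1) ^ 2 ≤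
          ((k + 2) ^ (max e f)) ^ 2 := Nat.pow_le_pow_left (by omega) 2
      have h9 := hmono k (max e f * 2) (max e f * 2 + 1) (by omega)
      rw [← pow_mul] at h8
      omega
    · exact Nat.zero_le _
  | comp cf cg ihf ihg =>
    obtain ⟨e, he⟩ := ihf
    refine ⟨e, fun k n => ?_⟩
    rw [evalN_comp]
    split_ifs
    · exact Nat.zero_le _
    · exact he _ _
    · exact Nat.zero_le _
  | prec cf cg ihf ihg =>
    obtain ⟨e, he⟩ := ihf
    obtain ⟨f, hf⟩ := ihg
    refine ⟨max e f, fun k n => ?_⟩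
    rw [← Nat.pair_unpair n]
    rcases n.unpair.2 with _ | y
    · rw [evalN_prec_zero]
      split_ifs
      · exact (he _ _).trans (hmono k _ _ (le_max_left e f))
      · exact Nat.zero_le _
    · rcases k with _ | k
      · rw [evalN_of_le (Nat.zero_le _)]; exact Nat.zero_le _
      · rw [evalN_prec_succ]
        split_ifs
        · exact Nat.zero_le _
        · exact (hf _ _).trans (hmono _ _ _ (le_max_right e f))
        · exact Nat.zero_le _
  | rfind' cf ih =>
    refine ⟨1, fun k => ?_⟩
    simp only [pow_one]
    induction k with
    | zero => intro n; rw [evalN_of_le (Nat.zero_le _)]; exact Nat.zero_le _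
    | succ k ih =>
      intro n
      have h2 := Nat.unpair_right_le n
      have h3 := ih (Nat.pair n.unpair.1 (n.unpair.2 + 1))
      rw [← Nat.pair_unpair n, evalN_rfind, Nat.pair_unpair n, Nat.add_sub_cancel]
      split_ifs <;> omega

/-- Bounded evaluation of `c` takes polynomial time. -/
def EvalPT (c : Code) : Prop := PT (fun _ => 0) fun p : ℕ × ℕ => evalN c p.1 p.2

theorem EvalPT.comp {c : Code} (h : EvalPT c) {α : Type} [Enc α] {B : α → ℕ} {k n : α → ℕ}
    (hk : PT B k) (hn : PT B n) : PT B fun x => evalN c (k x) (n x) :=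
  PT.comp₀ h (hk.prodMk hn)

/-- Each level of the recursion costs one unit of fuel, so for recursion argument `y` and fuel `k`
the value at level `j` is computed bottom-up with fuel `k - y + j`. At `j = y` this is `k`, since `y
≤ n < k` in the non-trivial case. -/
theorem EvalPT.prec {cf cg : Code} (hf : EvalPT cf) (hg : EvalPT cg) :
    EvalPT (.prec cf cg) := by
  set init : ℕ × ℕ → ℕ := fun p => if Nat.pair p.2.unpair.1 0 < p.1 - p.2.unpair.2 then
    evalN cf (p.1 - p.2.unpair.2) p.2.unpair.1 else 0 with hinit
  set step : ℕ × ℕ → ℕ → ℕ → ℕ := fun p j r =>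
    if Nat.pair p.2.unpair.1 (j + 1) < p.1 - p.2.unpair.2 + j + 1 then
      if r = 0 then 0 else evalN cg (p.1 - p.2.unpair.2 + j + 1)
        (Nat.pair p.2.unpair.1 (Nat.pair j (r - 1)))
    else 0 with hstep
  have key : ∀ p j, Nat.rec (motive := fun _ => ℕ) (init p) (step p) j =
      evalN (.prec cf cg) (p.1 - p.2.unpair.2 + j) (Nat.pair p.2.unpair.1 j) := by
    intro p j
    induction j with
    | zero => exact (evalN_prec_zero cf cg _ _).symm
    | succ j ih => rw [← Nat.add_assoc, evalN_prec_succ, ← ih]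
  obtain ⟨e, he⟩ := exists_evalN_le (.prec cf cg)
  have hPT : PT (fun _ => 0) fun p : ℕ × ℕ =>
      Nat.rec (motive := fun _ => ℕ) (init p) (step p) p.2.unpair.2 := by
    refine PT.natRec (B' := fun _ => 0) (T := fun p => 2 * (sz p + 2) ^ e + 1) (by fun_prop) ?_ ?_
      (by fun_prop) (fun p i hi => ?_) fun _ _ _ => Nat.zero_le _
    · exact PT.iteLt (by fun_prop) (by fun_prop) (hf.comp (by fun_prop) (by fun_prop)) (.const 0)
    · exact PT.iteLt (by fun_prop) (by fun_prop) (PT.iteEq (by fun_prop) (.const 0) (.const 0)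
        (hg.comp (by fun_prop) (by fun_prop))) (.const 0)
    · have h1 := Nat.unpair_right_le p.2
      have h2 : p.1 - p.2.unpair.2 + i + 2 ≤ sz p + 2 := by
        rw [sz_prod, sz_nat, sz_nat]; omega
      rw [key, sz_nat]
      have := (he (p.1 - p.2.unpair.2 + i) (Nat.pair p.2.unpair.1 i)).trans
        (Nat.pow_le_pow_left h2 e)
      omega
  refine (PT.iteLt (f := fun p : ℕ × ℕ => p.2) (g := fun p : ℕ × ℕ => p.1) (by fun_prop)
    (by fun_prop) hPT (.const 0)).congr fun p => ?_
  rw [key]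
  split_ifs with h
  · have := Nat.unpair_right_le p.2
    rw [Nat.sub_add_cancel (by omega), Nat.pair_unpair]
  · exact evalN_of_le (by omega)

theorem EvalPT.rfind {cf : Code} (hf : EvalPT cf) : EvalPT (.rfind' cf) := by
  -- Here `r = 0` means that the search goes on, and `r = v + 1` that it ended with `evalN` value
  -- `v`. Thus failure is stored as `1` and the root `m + j` as `m + j + 2`. After `p.1` rounds the
  -- fuel is used up.
  set step : ℕ × ℕ → ℕ → ℕ → ℕ := fun p j r =>
    if r = 0 then
      if Nat.pair p.2.unpair.1 (p.2.unpair.2 + j) < p.1 - j then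
        if evalN cf (p.1 - j) (Nat.pair p.2.unpair.1 (p.2.unpair.2 + j)) = 0 then 1
        else if evalN cf (p.1 - j) (Nat.pair p.2.unpair.1 (p.2.unpair.2 + j)) = 1 then
          p.2.unpair.2 + j + 2
        else 0
      else 1
    else r with hstep
  have hle : ∀ p j, Nat.rec (motive := fun _ => ℕ) 0 (step p) j ≤ p.1 + 2 := by
    intro p j
    induction j with
    | zero => exact Nat.zero_le _
    | succ j ih =>
      have := Nat.right_le_pair p.2.unpair.1 (p.2.unpair.2 + j)
      simp only [hstep] at ih ⊢
      split_ifs <;> omega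
  have key : ∀ p j, (Nat.rec (motive := fun _ => ℕ) 0 (step p) j = 0 →
      evalN (.rfind' cf) p.1 p.2 =
        evalN (.rfind' cf) (p.1 - j) (Nat.pair p.2.unpair.1 (p.2.unpair.2 + j))) ∧
      (Nat.rec (motive := fun _ => ℕ) 0 (step p) j ≠ 0 →
        Nat.rec (motive := fun _ => ℕ) 0 (step p) j = evalN (.rfind' cf) p.1 p.2 + 1) := by
    intro p j
    induction j with
    | zero => simp
    | succ j ih =>
      have h1 := evalN_rfind cf (p.1 - j) p.2.unpair.1 (p.2.unpair.2 + j)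
      rw [Nat.sub_sub, Nat.add_assoc p.2.unpair.2] at h1
      generalize hr : Nat.rec (motive := fun _ => ℕ) 0 (step p) j = r at ih
      have h2 : Nat.rec (motive := fun _ => ℕ) 0 (step p) (j + 1) = step p j r := by rw [← hr]
      rw [h2]
      simp only [hstep]
      obtain ⟨ih1, ih2⟩ := ih
      by_cases h0 : r = 0
      · rw [ih1 h0, if_pos h0, h1]
        split_ifs <;> simp
        omega
      · rw [if_neg h0]
        exact ⟨fun h => absurd h h0, ih2⟩
  have hPT : PT (fun _ => 0) fun p : ℕ × ℕ => Nat.rec (motive := fun _ => ℕ) 0 (step p) p.1 := by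
    refine PT.natRec (init := fun _ => 0) (B' := fun _ => 0) (T := fun p => 2 * (sz p + 2) + 1)
      (by fun_prop) (.const 0) ?_ (by fun_prop) (fun p i hi => ?_) fun _ _ _ => Nat.zero_le _
    · refine PT.iteEq (by fun_prop) (.const 0) (PT.iteLt (by fun_prop) (by fun_prop)
        (PT.iteEq (hf.comp (by fun_prop) (by fun_prop)) (.const 0) (.const 1)
          (PT.iteEq (hf.comp (by fun_prop) (by fun_prop)) (.const 1) (by fun_prop) (.const 0)))
            (.const 1)) (by fun_prop)
    · have := hle p i
      rw [sz_nat, sz_prod, sz_nat]; omega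
  refine hPT.pred.congr fun p => ?_
  have := key p p.1
  by_cases h : Nat.rec (motive := fun _ => ℕ) 0 (step p) p.1 = 0
  · rw [this.1 h, h]; exact evalN_of_le (by omega)
  · rw [this.2 h]; rfl

theorem evalPT (c : Code) : EvalPT c := by
  induction c with
  | zero =>
    exact PT.congr (g := fun p : ℕ × ℕ => evalN .zero p.1 p.2) (by fun_prop)
      fun p => evalN_zero p.1 p.2
  | succ =>
    exact PT.congr (g := fun p : ℕ × ℕ => evalN .succ p.1 p.2) (by fun_prop)
      fun p => evalN_succ p.1 p.2
  | left =>
    exact PT.congr (g := fun p : ℕ × ℕ => evalN .left p.1 p.2) (by fun_prop)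
      fun p => evalN_left p.1 p.2
  | right =>
    exact PT.congr (g := fun p : ℕ × ℕ => evalN .right p.1 p.2) (by fun_prop)
      fun p => evalN_right p.1 p.2
  | pair cf cg hf hg =>
    refine PT.congr (g := fun p : ℕ × ℕ => evalN (.pair cf cg) p.1 p.2) ?_
      fun p => evalN_pair cf cg p.1 p.2
    exact PT.iteLt (by fun_prop) (by fun_prop) (PT.iteEq hf (.const 0) (.const 0)
      (PT.iteEq hg (.const 0) (.const 0) (PT.succ (PT.nat_pair (PT.pred hf) (PT.pred hg)))))
      (.const 0)
  | comp cf cg hf hg =>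
    refine PT.congr (g := fun p : ℕ × ℕ => evalN (.comp cf cg) p.1 p.2) ?_
      fun p => evalN_comp cf cg p.1 p.2
    exact PT.iteLt (by fun_prop) (by fun_prop) (PT.iteEq hg (.const 0) (.const 0)
      (hf.comp (by fun_prop) (PT.pred hg))) (.const 0)
  | prec cf cg hf hg => exact hf.prec hg
  | rfind' cf hf => exact hf.rfind

/-! ## Slowly growing functions -/

/-- The largest value of `c` that evaluation with fuel `n` finds on the arguments below `n`. -/
def slow (c : Code) (n : ℕ) : ℕ :=
  Nat.rec (motive := fun _ => ℕ) 0 (fun i r => max r (evalN c n i - 1)) n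

theorem le_rec_max_iff {f : ℕ → ℕ} {m b : ℕ} (hb : 0 < b) :
    b ≤ Nat.rec (motive := fun _ => ℕ) 0 (fun i r => max r (f i)) m ↔ ∃ i < m, b ≤ f i := by
  induction m with
  | zero => simp; omega
  | succ m ih => simp only [le_max_iff, ih, Nat.lt_succ_iff_lt_or_eq, or_and_right, exists_or,
      exists_eq_left]

theorem le_slow_iff {c : Code} {n b : ℕ} (hb : 0 < b) :
    b ≤ slow c n ↔ ∃ i < n, b ≤ evalN c n i - 1 := le_rec_max_iff hb

theorem slow_PT (c : Code) : PT (fun _ => 0) (slow c) := by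
  obtain ⟨e, he⟩ := exists_evalN_le c
  have hmax : ∀ a b : ℕ, max a b = if a ≤ b then b else a := fun a b => by
    split_ifs <;> omega
  refine PT.natRec (init := fun _ => 0) (n := fun n : ℕ => n) (B' := fun _ => 0)
    (step := fun n i r => max r (evalN c n i - 1)) (T := fun n => 2 * (sz n + 2) ^ e + 1)
    (by fun_prop) (.const 0) ?_ (by fun_prop) (fun n i hi => ?_) fun _ _ _ => Nat.zero_le _
  · simp only [hmax]
    have h := PT.pred ((evalPT c).comp (B := fun _ => 0)
      (k := fun q : ℕ × ℕ × ℕ => q.1) (n := fun q => q.2.1) (by fun_prop) (by fun_prop))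
    exact PT.iteLe (by fun_prop) h h (by fun_prop)
  · have h1 : Nat.rec (motive := fun _ => ℕ) 0 (fun i r => max r (evalN c n i - 1)) i ≤
        (n + 2) ^ e := by
      by_contra! h
      obtain ⟨j, -, hj⟩ := (le_rec_max_iff (Nat.succ_pos _)).1 h
      have h3 := he n j
      omega
    have h2 : (n + 2) ^ e ≤ (sz n + 2) ^ e := Nat.pow_le_pow_left (by rw [sz_nat]; omega) e
    rw [sz_nat]; omega

theorem slow_computable (c : Code) : Computable (slow c) := by
  have h1 : Primrec fun q : ℕ × ℕ => evalN c q.1 q.2 := by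
    have := Primrec.encode.comp (Nat.Partrec.Code.primrec_evaln.comp
      (Primrec.pair (Primrec.pair Primrec.fst (Primrec.const c)) Primrec.snd :
        Primrec fun q : ℕ × ℕ => ((q.1, c), q.2)))
    refine this.of_eq fun q => ?_
    simp only [evalN]
    cases evaln q.1 c q.2 <;> rfl
  have h2 : Primrec₂ fun (n : ℕ) (q : ℕ × ℕ) => max q.2 (evalN c n q.1 - 1) :=
    Primrec.nat_max.comp (Primrec.snd.comp Primrec.snd) (Primrec.nat_sub.comp
      (h1.comp (Primrec.pair Primrec.fst (Primrec.fst.comp Primrec.snd))) (Primrec.const 1))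
  exact (Primrec.nat_rec' Primrec.id (Primrec.const 0) h2).to_comp

/-- Every unbounded computable nondecreasing function has a lower bound with the same properties that
can be computed in time polynomial in the value of the argument. -/
theorem exists_slow {lam : ℕ → ℕ} (hc : Computable lam) (hm : Monotone lam)
    (hu : ∀ b, ∃ n, b ≤ lam n) : ∃ g : ℕ → ℕ, PT (fun _ => 0) g ∧ Computable g ∧ Monotone g ∧
      (∀ b, ∃ n, b ≤ g n) ∧ ∀ n, g n ≤ lam n := by
  obtain ⟨c, hcode⟩ := Nat.Partrec.Code.exists_code.1 (Partrec.nat_iff.1 hc.partrec)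
  have hval : ∀ {k i b}, 0 < b → b ≤ evalN c k i - 1 → b ≤ lam i := by
    intro k i b hb h
    have h1 : evalN c k i - 1 ∈ evaln k c i := evalN_eq_succ.1 (by omega)
    have h2 := Nat.Partrec.Code.evaln_sound h1
    rw [hcode] at h2
    rwa [show evalN c k i - 1 = lam i by simpa using h2] at h
  refine ⟨slow c, slow_PT c, slow_computable c, fun n n' h => ?_, fun b => ?_, fun n => ?_⟩
  -- Both the range of arguments and the fuel grow with `n`, so a value once found is found again.
  · rcases Nat.eq_zero_or_pos (slow c n) with h0 | h0
    · rw [h0]; exact Nat.zero_le _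
    · obtain ⟨i, hi, hv⟩ := (le_slow_iff h0).1 le_rfl
      exact (le_slow_iff h0).2 ⟨i, hi.trans_le h, hv.trans
        (Nat.sub_le_sub_right (evalN_mono h) 1)⟩
  · rcases Nat.eq_zero_or_pos b with rfl | hb
    · exact ⟨0, Nat.zero_le _⟩
    · obtain ⟨i, hi⟩ := hu b
      have h1 : lam i ∈ c.eval i := by rw [hcode]; simp
      obtain ⟨k, hk⟩ := Nat.Partrec.Code.evaln_complete.1 h1
      have h2 := evalN_eq_succ.2 hk
      -- Large enough both for the fuel needed to evaluate at `i` and for `i` to be among the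
      -- arguments tried.
      refine ⟨max k (i + 1), (le_slow_iff hb).2 ⟨i, by omega, ?_⟩⟩
      have := evalN_mono (c := c) (n := i) (le_max_left k (i + 1))
      omega
  · rcases Nat.eq_zero_or_pos (slow c n) with h0 | h0
    · rw [h0]; exact Nat.zero_le _
    · obtain ⟨i, hi, hv⟩ := (le_slow_iff h0).1 le_rfl
      exact (hval h0 hv).trans (hm hi.le)

end WhileLang

/-! ## Formulas as plain data -/

/-- A formula as plain data: the number of variables and the list of clauses. -/
abbrev RawCNF : Type := ℕ × List (List (ℕ × Bool))

def CNFFormula.raw (F : CNFFormula) : RawCNF :=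
  (F.n, F.clauses.map fun C => C.map fun l => (l.1.val, l.2))

theorem CNFFormula.enc_raw (F : CNFFormula) : Enc.enc F.raw = F.code := by
  simp only [Enc.enc, raw, code, List.map_map, Function.comp_def]

/-- Some truth assignment satisfies all clauses. -/
def SatClauses (cls : List (List (ℕ × Bool))) : Prop :=
  ∃ τ : ℕ → Bool, ∀ C ∈ cls, ∃ l ∈ C, τ l.1 = l.2

theorem CNFFormula.satisfiable_raw (F : CNFFormula) : SatClauses F.raw.2 ↔ F.Satisfiable := by
  constructor
  · rintro ⟨τ, h⟩
    refine ⟨fun v => τ v, fun C hC => ?_⟩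
    obtain ⟨l, hl, e⟩ := h _ (List.mem_map_of_mem hC)
    obtain ⟨l, hl', rfl⟩ := List.mem_map.1 hl
    exact ⟨l, hl', e⟩
  · rintro ⟨τ, h⟩
    refine ⟨fun v => if hv : v < F.n then τ ⟨v, hv⟩ else false, fun C hC => ?_⟩
    obtain ⟨C, hC', rfl⟩ := List.mem_map.1 hC
    obtain ⟨l, hl, e⟩ := h C hC'
    exact ⟨_, List.mem_map_of_mem hl, by simpa using e⟩

/-! ## Tuples of truth values -/

/-- All tuples of truth values of the length of `S`. -/
def boolTuples (S : List ℕ) : List (List Bool) :=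
  S.foldl (fun acc _ => acc.map (fun r => false :: r) ++ acc.map fun r => true :: r) [[]]

theorem boolTuples_concat (S : List ℕ) (v : ℕ) : boolTuples (S ++ [v]) =
    (boolTuples S).map (fun r => false :: r) ++ (boolTuples S).map fun r => true :: r := by
  simp [boolTuples]

theorem mem_boolTuples {S : List ℕ} {r : List Bool} :
    r ∈ boolTuples S ↔ r.length = S.length := by
  induction S using List.reverseRecOn generalizing r with
  | nil => simp [boolTuples]
  | append_singleton S v ih =>
    rw [boolTuples_concat, List.length_append, List.length_singleton]
    rcases r with _ | ⟨_ | _, r⟩ <;> simp [ih]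

theorem nodup_boolTuples (S : List ℕ) : (boolTuples S).Nodup := by
  induction S using List.reverseRecOn with
  | nil => simp [boolTuples]
  | append_singleton S v ih =>
    rw [boolTuples_concat]
    refine List.Nodup.append (ih.map (List.cons_injective)) (ih.map (List.cons_injective)) ?_
    intro r h1 h2
    obtain ⟨r1, -, rfl⟩ := List.mem_map.1 h1
    obtain ⟨r2, -, h⟩ := List.mem_map.1 h2
    simp at h

theorem length_boolTuples (S : List ℕ) : (boolTuples S).length = 2 ^ S.length := by
  induction S using List.reverseRecOn with
  | nil => simp [boolTuples]
  | append_singleton S v ih =>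
    rw [boolTuples_concat, List.length_append, List.length_map, List.length_map, ih,
      List.length_append, List.length_singleton, pow_succ]
    ring

/-- The only exponential step of the reduction, and the reason for a parameter exponential in the
length of the scope. -/
theorem boolTuples_PT : PT (fun S : List ℕ => 2 ^ S.length) boolTuples := by
  refine PT.foldl' (l := fun S : List ℕ => S) (init := fun _ => [[]])
    (step := fun _ acc _ => acc.map (fun r => false :: r) ++ acc.map fun r => true :: r)
    (by fun_prop) (by fun_prop) (by fun_prop)
    (T := fun S => 2 ^ S.length * (4 * sz S + 2) + 1) ?_ fun S m hm => ?_
  · exact ((PB.self (B := fun S : List ℕ => 2 ^ S.length)).mul (by fun_prop)).add (by fun_prop)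
  · have h1 : sz (boolTuples m) ≤ (boolTuples m).length * (4 * m.length + 1 + 1) + 1 := by
      refine sz_le_of_forall fun r hr => ?_
      rw [mem_boolTuples] at hr
      refine (sz_le_of_forall (K := 3) fun b _ => sz_bool b).trans ?_
      omega
    rw [length_boolTuples] at h1
    refine h1.trans (Nat.add_le_add_right (Nat.mul_le_mul
      (Nat.pow_le_pow_right (by omega) hm.length_le) ?_) 1)
    have := hm.length_le
    have := length_lt_sz S
    omega

/-- The tuples of values for the variables `S` that falsify no clause. -/
def rel (cls : List (List (ℕ × Bool))) (S : List ℕ) : List (List Bool) :=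
  (boolTuples S).filter fun r => cls.all fun C => C.any fun l =>
    !decide ((l.1, !l.2) ∈ S.zip r)

theorem rel_PT : PT (fun q : List (List (ℕ × Bool)) × List ℕ => 2 ^ q.2.length)
    fun q => rel q.1 q.2 := by
  have h := boolTuples_PT.comp (B := fun q : List (List (ℕ × Bool)) × List ℕ => 2 ^ q.2.length)
    (f := fun q => q.2) (by fun_prop) .self
  unfold rel
  refine PT.filter' h (PT.all (by fun_prop) (PT.any (by fun_prop) (PT.not ?_)))
  exact PT.decideMem (by fun_prop) (by fun_prop)

theorem mem_zip_map {α β : Type} {S : List α} {τ : α → β} {p : α × β} :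
    p ∈ S.zip (S.map τ) ↔ p.1 ∈ S ∧ p.2 = τ p.1 := by
  have : S.zip (S.map τ) = S.map fun v => (v, τ v) := by
    induction S with
    | nil => rfl
    | cons v S ih => simp [ih]
  rw [this, List.mem_map]
  constructor
  · rintro ⟨v, hv, rfl⟩; exact ⟨hv, rfl⟩
  · rintro ⟨h1, h2⟩; exact ⟨p.1, h1, by rw [← h2]⟩

/-- The zip of `S` with `S.map τ` is the graph of `τ` on `S`. A literal whose variable is outside
`S` is not falsified, so only clauses inside `S` constrain the tuple. -/
theorem map_mem_rel {cls : List (List (ℕ × Bool))} {S : List ℕ} {τ : ℕ → Bool} :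
    S.map τ ∈ rel cls S ↔ ∀ C ∈ cls, ∃ l ∈ C, l.1 ∈ S → τ l.1 = l.2 := by
  have : ∀ l : ℕ × Bool, ((l.1, !l.2) ∉ S.zip (S.map τ)) ↔ (l.1 ∈ S → τ l.1 = l.2) := by
    intro l
    rw [mem_zip_map, not_and]
    refine imp_congr_right fun _ => ?_
    cases l.2 <;> cases τ l.1 <;> simp
  simp only [rel, List.mem_filter, mem_boolTuples, List.length_map, true_and, List.all_eq_true,
    List.any_eq_true, Bool.not_eq_true', decide_eq_false_iff_not, this]

theorem length_of_mem_rel {cls : List (List (ℕ × Bool))} {S : List ℕ} {r : List Bool}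
    (h : r ∈ rel cls S) : r.length = S.length :=
  mem_boolTuples.1 (List.mem_of_mem_filter h)

/-- Exhaustive search over all variables, needed for those `n` where `g n < 2` and the reduction is
not available. -/
theorem rel_range_ne_nil_iff {cls : List (List (ℕ × Bool))} {n : ℕ}
    (hn : ∀ C ∈ cls, ∀ l ∈ C, l.1 < n) : rel cls (List.range n) ≠ [] ↔ SatClauses cls := by
  constructor
  · intro h
    obtain ⟨r, hr⟩ := List.exists_mem_of_ne_nil _ h
    have hlen := length_of_mem_rel hr
    rw [List.length_range] at hlen
    have : r = (List.range n).map fun v => r.getD v false := by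
      refine List.ext_getElem (by simp [hlen]) fun i h1 h2 => ?_
      simp [h1]
    rw [this, map_mem_rel] at hr
    refine ⟨fun v => r.getD v false, fun C hC => ?_⟩
    obtain ⟨l, hl, e⟩ := hr C hC
    exact ⟨l, hl, e (List.mem_range.2 (hn C hC l hl))⟩
  · rintro ⟨τ, h⟩
    refine List.ne_nil_of_mem (a := (List.range n).map τ) (map_mem_rel.2 fun C hC => ?_)
    obtain ⟨l, hl, e⟩ := h C hC
    exact ⟨l, hl, fun _ => e⟩

/-! ## Removal of duplicates -/

/-- The elements of `l`, each once. -/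
def distinctElems (l : List (List ℕ)) : List (List ℕ) :=
  l.foldl (fun acc S => if decide (S ∈ acc) then acc else S :: acc) []

theorem distinctElems_concat (l : List (List ℕ)) (S : List ℕ) : distinctElems (l ++ [S]) =
    if S ∈ distinctElems l then distinctElems l else S :: distinctElems l := by
  simp [distinctElems]

theorem mem_distinctElems {l : List (List ℕ)} {S : List ℕ} : S ∈ distinctElems l ↔ S ∈ l := by
  induction l using List.reverseRecOn with
  | nil => simp [distinctElems]
  | append_singleton l S' ih =>
    rw [distinctElems_concat, List.mem_append, List.mem_singleton, ← ih]
    split_ifs with h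
    · exact ⟨Or.inl, fun h' => h'.elim _root_.id fun e => e ▸ h⟩
    · rw [List.mem_cons, or_comm]

theorem nodup_distinctElems (l : List (List ℕ)) : (distinctElems l).Nodup := by
  induction l using List.reverseRecOn with
  | nil => simp [distinctElems]
  | append_singleton l S' ih =>
    rw [distinctElems_concat]
    split_ifs with h
    · exact ih
    · exact List.nodup_cons.2 ⟨h, ih⟩

theorem length_distinctElems_le (l : List (List ℕ)) : (distinctElems l).length ≤ l.length := by
  induction l using List.reverseRecOn with
  | nil => simp [distinctElems]
  | append_singleton l S' ih =>
    rw [distinctElems_concat, List.length_append, List.length_singleton]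
    split_ifs with h
    · omega
    · rw [List.length_cons]; omega

theorem sz_distinctElems_le (l : List (List ℕ)) : sz (distinctElems l) ≤ sz l := by
  induction l using List.reverseRecOn with
  | nil => simp [distinctElems]
  | append_singleton l S' ih =>
    have := sz_append l [S']
    rw [sz_cons, sz_nil] at this
    rw [distinctElems_concat]
    split_ifs with h
    · omega
    · rw [sz_cons]; omega

theorem distinctElems_PT : PT (fun _ => 0) distinctElems :=
  PT.foldl' (l := fun l => l) (init := fun _ => [])
    (step := fun _ acc S => if decide (S ∈ acc) then acc else S :: acc)
    (by fun_prop) (by fun_prop) (by fun_prop) (T := fun l => sz l) (by fun_prop)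
    fun _ m hm => (sz_distinctElems_le m).trans (sz_le_of_prefix hm)

/-! ## The reduction from satisfiability -/

/-- The variables in the residue classes of `i`, `j` and `k` modulo `b`. -/
def tripleScope (b n i j k : ℕ) : List ℕ :=
  (List.range n).filter fun v => decide (v % b = i) || (decide (v % b = j) || decide (v % b = k))

theorem mem_tripleScope {b n i j k v : ℕ} :
    v ∈ tripleScope b n i j k ↔ v < n ∧ (v % b = i ∨ v % b = j ∨ v % b = k) := by
  simp [tripleScope]

/-- The unions of three residue classes modulo `b`. -/
def scopes (b n : ℕ) : List (List ℕ) :=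
  distinctElems ((List.range b).flatMap fun i => (List.range b).flatMap fun j =>
    (List.range b).map fun k => tripleScope b n i j k)

theorem mem_scopes {b n : ℕ} {S : List ℕ} :
    S ∈ scopes b n ↔ ∃ i < b, ∃ j < b, ∃ k < b, tripleScope b n i j k = S := by
  simp only [scopes, mem_distinctElems, List.mem_flatMap, List.mem_map, List.mem_range]

theorem length_scopes_le (b n : ℕ) : (scopes b n).length ≤ b ^ 3 := by
  refine (length_distinctElems_le _).trans (le_of_eq ?_)
  simp [List.length_flatMap]
  ring

/-- Being increasing gives distinct variables within a scope, and it tells these scopes apart from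
`[1, 0]`, the scope of the extra constraint. -/
theorem sorted_of_mem_scopes {b n : ℕ} {S : List ℕ} (h : S ∈ scopes b n) :
    S.Pairwise (· < ·) := by
  obtain ⟨i, -, j, -, k, -, rfl⟩ := mem_scopes.1 h
  exact List.pairwise_lt_range.filter _

theorem lt_of_mem_scopes {b n : ℕ} {S : List ℕ} (h : S ∈ scopes b n) : ∀ v ∈ S, v < n := by
  obtain ⟨i, -, j, -, k, -, rfl⟩ := mem_scopes.1 h
  exact fun v hv => (mem_tripleScope.1 hv).1

theorem ne_nil_of_mem_scopes {b n : ℕ} (hbn : b ≤ n) {S : List ℕ} (h : S ∈ scopes b n) :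
    S ≠ [] := by
  obtain ⟨i, hi, j, -, k, -, rfl⟩ := mem_scopes.1 h
  exact List.ne_nil_of_mem (a := i)
    (mem_tripleScope.2 ⟨by omega, Or.inl (Nat.mod_eq_of_lt hi)⟩)

/-- The map `v ↦ (v % b, v / b)` is injective and sends the scope into three residues times `n / b +
1` quotients. -/
theorem length_le_of_mem_scopes {b n : ℕ} {S : List ℕ} (h : S ∈ scopes b n) :
    S.length ≤ 3 * (n / max b 1 + 1) := by
  have hnd : S.Nodup := (sorted_of_mem_scopes h).imp ne_of_lt
  obtain ⟨i, hi, j, -, k, -, rfl⟩ := mem_scopes.1 h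
  rw [max_eq_left (by omega), ← List.toFinset_card_of_nodup hnd]
  refine (Finset.card_le_card_of_injOn (t := ({i, j, k} : Finset ℕ) ×ˢ Finset.range (n / b + 1))
    (fun v => (v % b, v / b)) (fun v hv => ?_) fun v _ w _ e => ?_).trans ?_
  · have hv := mem_tripleScope.1 (List.mem_toFinset.1 hv)
    have := Nat.div_le_div_right (c := b) hv.1.le
    simp only [Finset.coe_product, Set.mem_prod, Finset.mem_coe, Finset.mem_insert,
      Finset.mem_singleton, Finset.mem_range]
    exact ⟨hv.2, by omega⟩
  · simp only [Prod.mk.injEq] at e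
    rw [← Nat.div_add_mod v b, ← Nat.div_add_mod w b, e.1, e.2]
  · rw [Finset.card_product, Finset.card_range]
    exact Nat.mul_le_mul_right _ Finset.card_le_three

/-- Three variables lie in a common scope. -/
theorem exists_scope {b n : ℕ} (hb : 0 < b) {C : List (ℕ × Bool)} (hC : C.length ≤ 3)
    (hn : ∀ l ∈ C, l.1 < n) : ∃ S ∈ scopes b n, ∀ l ∈ C, l.1 ∈ S := by
  have hm : ∀ v, v % b < b := fun v => Nat.mod_lt v hb
  have key : ∀ u v w : ℕ, (∀ l ∈ C, l.1 = u ∨ l.1 = v ∨ l.1 = w) →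
      ∃ S ∈ scopes b n, ∀ l ∈ C, l.1 ∈ S := fun u v w h =>
    ⟨_, mem_scopes.2 ⟨_, hm u, _, hm v, _, hm w, rfl⟩, fun l hl => mem_tripleScope.2
      ⟨hn l hl, (h l hl).imp (congrArg (· % b)) (Or.imp (congrArg (· % b)) (congrArg (· % b)))⟩⟩
  match C, hC with
  -- Missing variables are padded with `0`; only its residue is used.
  | [], _ => exact key 0 0 0 (by simp)
  | [x], _ => exact key x.1 0 0 (by simp)
  | [x, y], _ => exact key x.1 y.1 0 (by simp)
  | [x, y, z], _ => exact key x.1 y.1 z.1 (by simp)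
  | _ :: _ :: _ :: _ :: _, h => simp only [List.length_cons] at h; omega

/-- The instance of the CSP that expresses the satisfiability of `cls`.  The first constraint
is satisfied by all assignments. -/
def reduction (b n : ℕ) (cls : List (List (ℕ × Bool))) : RawCSP :=
  (n, 2, ([1, 0], [[0, 0], [0, 1], [1, 0], [1, 1]]) ::
    (scopes b n).map fun S => (S, (rel cls S).map fun r => r.map Bool.toNat))

theorem toNat_map_injective : Function.Injective fun r : List Bool => r.map Bool.toNat := by
  refine List.map_injective_iff.2 fun a b h => ?_
  cases a <;> cases b <;> simp_all

/-- A solution satisfies each clause because the scope containing all its variables admits only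
tuples that do not falsify it. Conversely, restrictions of a satisfying assignment falsify nothing.
-/
theorem reduction_consistent {b n : ℕ} (hb : 0 < b) {cls : List (List (ℕ × Bool))}
    (hw : ∀ C ∈ cls, C.length ≤ 3) (hn : ∀ C ∈ cls, ∀ l ∈ C, l.1 < n) :
    (reduction b n cls).Consistent ↔ SatClauses cls := by
  constructor
  · rintro ⟨τ, h1, h2⟩
    have h1 : ∀ v < n, τ v < 2 := h1
    refine ⟨fun v => decide (τ v = 1), fun C hC => ?_⟩
    obtain ⟨S, hS, hCS⟩ := exists_scope hb (hw C hC) (hn C hC)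
    have h3 : S.map τ ∈ (rel cls S).map fun r => r.map Bool.toNat :=
      h2 _ (List.mem_cons_of_mem _ (List.mem_map_of_mem hS))
    have h4 : S.map τ = (S.map fun v => decide (τ v = 1)).map Bool.toNat := by
      rw [List.map_map]
      refine List.map_congr_left fun v hv => ?_
      have := h1 v (lt_of_mem_scopes hS v hv)
      simp only [Function.comp_apply]
      interval_cases τ v <;> rfl
    rw [h4, List.mem_map_of_injective toNat_map_injective, map_mem_rel] at h3
    obtain ⟨l, hl, e⟩ := h3 C hC
    exact ⟨l, hl, e (hCS l hl)⟩
  · rintro ⟨τ, h⟩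
    refine ⟨fun v => (τ v).toNat, fun v _ => Bool.toNat_lt _, fun C hC => ?_⟩
    rcases List.mem_cons.1 hC with rfl | hC
    · cases h1 : τ 1 <;> cases h0 : τ 0 <;> simp [h0, h1]
    · obtain ⟨S, hS, rfl⟩ := List.mem_map.1 hC
      have : S.map (fun v => (τ v).toNat) = (S.map τ).map Bool.toNat := by simp
      rw [this, List.mem_map_of_injective toNat_map_injective, map_mem_rel]
      intro C hC
      obtain ⟨l, hl, e⟩ := h C hC
      exact ⟨l, hl, fun _ => e⟩

/-- A constraint given as plain data. -/
theorem CSPConstraint.exists_raw_eq {n d : ℕ} {C : RawConstraint} (h1 : C.1 ≠ [])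
    (h2 : C.1.Nodup) (h3 : ∀ v ∈ C.1, v < n) (h4 : C.2.Nodup)
    (h5 : ∀ r ∈ C.2, r.length = C.1.length) (h6 : ∀ r ∈ C.2, ∀ w ∈ r, w < d) :
    ∃ c : CSPConstraint n d, c.raw = C := by
  obtain ⟨S, R⟩ := C
  have hS : ∃ S' : List (Fin n), S'.map Fin.val = S := by
    refine ⟨S.pmap Fin.mk h3, ?_⟩
    simp [List.map_pmap]
  have hR : ∃ R' : List (List (Fin d)), R'.map (fun r => r.map Fin.val) = R := by
    refine ⟨R.pmap (fun r (h : ∀ w ∈ r, w < d) => r.pmap Fin.mk h) h6, ?_⟩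
    simp [List.map_pmap]
  obtain ⟨S, rfl⟩ := hS
  obtain ⟨R, rfl⟩ := hR
  exact ⟨⟨S, R, by simpa using h1, h2.of_map _, h4.of_map _, fun r hr => by
    simpa using h5 _ (List.mem_map_of_mem hr)⟩, rfl⟩

/-- An instance given as plain data. -/
theorem CSPInstance.exists_raw_eq {x : RawCSP} (h : ∀ C ∈ x.2.2, ∃ c : CSPConstraint x.1 x.2.1,
    c.raw = C) (hd : x.2.2.Pairwise fun C C' => C.1 ≠ C'.1) : ∃ I : CSPInstance, I.raw = x := by
  obtain ⟨n, d, cs⟩ := x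
  have hcs : ∃ l : List (CSPConstraint n d), l.map CSPConstraint.raw = cs := by
    clear hd
    induction cs with
    | nil => exact ⟨[], rfl⟩
    | cons C cs ih =>
      obtain ⟨l, hl⟩ := ih fun C' hC' => h C' (List.mem_cons_of_mem _ hC')
      obtain ⟨c, hc⟩ := h C List.mem_cons_self
      exact ⟨c :: l, by rw [List.map_cons, hc, hl]⟩
  obtain ⟨l, rfl⟩ := hcs
  refine ⟨⟨n, d, l, (List.pairwise_map.1 hd).imp fun hne hs => hne ?_⟩, rfl⟩
  simp [CSPConstraint.raw, hs.1]

/-- The reduction produces normalized instances with few constraints. -/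
theorem exists_instance_reduction {b n : ℕ} (hb : 2 ≤ b) (hbn : b ≤ n)
    (cls : List (List (ℕ × Bool))) : ∃ I : CSPInstance, I.raw = reduction b n cls ∧
      I.Normalized ∧ I.cons ≤ b ^ 3 + 1 := by
  obtain ⟨I, hI⟩ := CSPInstance.exists_raw_eq (x := reduction b n cls) (fun C hC => by
    refine CSPConstraint.exists_raw_eq ?_ ?_ ?_ ?_ ?_ ?_
    all_goals rcases List.mem_cons.1 hC with rfl | hC
    · simp
    · obtain ⟨S, hS, rfl⟩ := List.mem_map.1 hC
      exact ne_nil_of_mem_scopes hbn hS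
    · simp
    · obtain ⟨S, hS, rfl⟩ := List.mem_map.1 hC
      exact (sorted_of_mem_scopes hS).imp ne_of_lt
    · simp [reduction]; omega
    · obtain ⟨S, hS, rfl⟩ := List.mem_map.1 hC
      exact lt_of_mem_scopes hS
    · simp
    · obtain ⟨S, hS, rfl⟩ := List.mem_map.1 hC
      exact ((nodup_boolTuples S).filter _).map toNat_map_injective
    · simp
    · obtain ⟨S, hS, rfl⟩ := List.mem_map.1 hC
      intro r hr
      obtain ⟨r, hr', rfl⟩ := List.mem_map.1 hr
      simpa using length_of_mem_rel hr'
    · simp [reduction]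
    · obtain ⟨S, hS, rfl⟩ := List.mem_map.1 hC
      intro r hr w hw
      obtain ⟨r, hr, rfl⟩ := List.mem_map.1 hr
      obtain ⟨w, -, rfl⟩ := List.mem_map.1 hw
      exact Bool.toNat_lt w) (by
    refine List.pairwise_cons.2 ⟨fun C hC => ?_, List.pairwise_map.2 (nodup_distinctElems _)⟩
    obtain ⟨S, hS, rfl⟩ := List.mem_map.1 hC
    -- The scope `[1, 0]` of the first constraint is decreasing, all others are increasing.
    rintro rfl
    simpa using sorted_of_mem_scopes hS)
  refine ⟨I, hI, ⟨fun v => ?_, fun w => ?_⟩, ?_⟩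
  · have hn : I.n = n := congrArg Prod.fst hI
    have hv : v.val < n := hn ▸ v.2
    -- A one-literal clause serves to find a scope through the variable `v`.
    obtain ⟨S, hS, h⟩ := exists_scope (b := b) (n := n) (by omega) (C := [(v.val, true)]) (by simp)
      (by simpa using hv)
    have hC : (S, (rel cls S).map fun r => r.map Bool.toNat) ∈ I.raw.2.2 := by
      rw [hI]; exact List.mem_cons_of_mem _ (List.mem_map_of_mem hS)
    obtain ⟨C, hC, e⟩ := List.mem_map.1 hC
    refine ⟨C, hC, ?_⟩
    have h' := h _ List.mem_cons_self
    rw [show S = C.scope.map Fin.val from (congrArg Prod.fst e).symm] at h'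
    exact (List.mem_map_of_injective Fin.val_injective).1 h'
  · have hd : I.d = 2 := congrArg (fun x => x.2.1) hI
    have hw : w.val < 2 := hd ▸ w.2
    -- The relations coming from the formula may be empty; the full binary relation makes both
    -- values occur.
    have hC : ([1, 0], [[0, 0], [0, 1], [1, 0], [1, 1]]) ∈ I.raw.2.2 := by
      rw [hI]; exact List.mem_cons_self
    obtain ⟨C, hC, e⟩ := List.mem_map.1 hC
    have hr : [w.val, w.val] ∈ C.raw.2 := by
      rw [e]; interval_cases w.val <;> simp
    obtain ⟨r, hr, e'⟩ := List.mem_map.1 hr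
    refine ⟨C, hC, r, hr, (List.mem_map_of_injective Fin.val_injective).1 ?_⟩
    rw [e']; simp
  · have : I.cons = I.raw.2.2.length := by simp [CSPInstance.raw, CSPInstance.cons]
    rw [this, hI]
    simpa [reduction] using length_scopes_le b n

/-! ## The running time of the reduction -/

namespace WhileLang.PT

@[fun_prop]
theorem toNat {α : Type} [Enc α] {B : α → ℕ} {f : α → Bool} (hf : PT B f) :
    PT B fun x => (f x).toNat :=
  hf.recode fun x => by cases f x <;> rfl

end WhileLang.PT

/-- A bound for the number of variables of a constraint, if the variables are divided into `b`
classes. -/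
def scopeBound (b n : ℕ) : ℕ := 3 * (n / max b 1 + 1)

/-- For `b < 2` the bound exceeds `n`, so exhaustive search fits into the same time parameter as the
reduction. -/
theorem le_scopeBound {b n : ℕ} (hb : b < 2) : n ≤ scopeBound b n := by
  have : n / max b 1 = n := by rw [max_eq_right (by omega), Nat.div_one]
  rw [scopeBound, this]; omega

theorem scopeBound_mul_le {b n : ℕ} (hbn : b ≤ n) : scopeBound b n * b ≤ 6 * n := by
  rcases Nat.eq_zero_or_pos b with rfl | hb
  · simp
  · rw [scopeBound, max_eq_left hb]
    have := Nat.div_mul_le_self n b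
    nlinarith

theorem tripleScope_PT : PT (fun _ => 0) fun q : (ℕ × ℕ) × ℕ × ℕ × ℕ =>
    tripleScope q.1.1 q.1.2 q.2.1 q.2.2.1 q.2.2.2 := by
  unfold tripleScope
  exact PT.filter' (by fun_prop) (PT.or (by fun_prop) (PT.or (by fun_prop) (by fun_prop)))

theorem scopes_PT : PT (fun _ => 0) fun q : ℕ × ℕ => scopes q.1 q.2 := by
  unfold scopes
  refine distinctElems_PT.comp₀ (PT.flatMap' (by fun_prop) (PT.flatMap' (by fun_prop)
    (PT.map' (by fun_prop) ?_)))
  exact tripleScope_PT.comp₀ (f := fun q : (((ℕ × ℕ) × ℕ) × ℕ) × ℕ =>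
    (q.1.1.1, q.1.1.2, q.1.2, q.2)) (by fun_prop)

/-! ### From subexponential CSP algorithms to 3-CNF-Sat -/

section

variable {g : ℕ → ℕ}

theorem reduction_PT (hg : PT (fun _ => 0) g) :
    PT (fun x : RawCNF => 2 ^ scopeBound (g x.1) x.1) fun x => reduction (g x.1) x.1 x.2 := by
  have h1 : PT (fun x : RawCNF => 2 ^ scopeBound (g x.1) x.1) fun x => scopes (g x.1) x.1 :=
    scopes_PT.comp₀ (f := fun x : RawCNF => (g x.1, x.1))
      ((hg.comp₀ (f := fun x : RawCNF => x.1) (by fun_prop)).prodMk (by fun_prop))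
  have h2 : PT (fun q : RawCNF × List ℕ => 2 ^ q.2.length) fun q => rel q.1.2 q.2 :=
    rel_PT.comp (f := fun q : RawCNF × List ℕ => (q.1.2, q.2)) (by fun_prop) .self
  have h3 := PT.map h1 (h := fun x S => (S, (rel x.2 S).map fun r => r.map Bool.toNat))
    (PT.prodMk (by fun_prop) (PT.map' h2 (by fun_prop))) .self fun x S hS =>
      Nat.pow_le_pow_right (by omega) (length_le_of_mem_scopes hS)
  unfold reduction
  fun_prop

/-- If `2 ≤ g n`, the search is run on the empty list of variables to keep it cheap; its result is
then discarded. -/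
theorem rel_range_PT (hg : PT (fun _ => 0) g) :
    PT (fun x : RawCNF => 2 ^ scopeBound (g x.1) x.1) fun x =>
      !(rel x.2 (if g x.1 < 2 then List.range x.1 else [])).isEmpty := by
  refine PT.not (PT.isEmpty (rel_PT.comp
    (f := fun x : RawCNF => (x.2, if g x.1 < 2 then List.range x.1 else []))
    (PT.prodMk (by fun_prop) (PT.iteLt (hg.comp₀ (f := fun x : RawCNF => x.1) (by fun_prop))
      (by fun_prop) (by fun_prop) (by fun_prop))) (PB.self.mono fun x => ?_)))
  refine Nat.pow_le_pow_right (by omega) ?_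
  dsimp only
  split_ifs with h
  · rw [List.length_range]; exact le_scopeBound h
  · exact Nat.zero_le _

/-- Satisfiability of `3`-CNF formulas can be decided with the help of a program for the instances
that the reduction produces. -/
theorem exists_sat_program (hg : PT (fun _ => 0) g) (hgn : ∀ n, g n ≤ n) {q : Cmd}
    {U : CSPInstance → ℕ} {K : Set CSPInstance}
    (hq : DecidesOn q CSPInstance.code K CSPInstance.Consistent U)
    (hK : ∀ I : CSPInstance, I.Normalized → 2 ≤ g I.n → I.cons ≤ g I.n ^ 3 + 1 → I ∈ K)
    {V : CNFFormula → ℕ} {e : ℕ}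
    (hU : ∀ (F : CNFFormula) (I : CSPInstance), I.n = F.n → I.d = 2 →
      I.code.size ≤ (2 ^ scopeBound (g F.n) F.n + F.code.size + 1) ^ e → U I ≤ V F)
    (he : ∀ x : RawCNF, sz (reduction (g x.1) x.1 x.2) ≤
      (2 ^ scopeBound (g x.1) x.1 + sz x + 1) ^ e) :
    ∃ (p : Cmd) (k e' : ℕ), DecidesOn p CNFFormula.code {F | F.WidthLE 3} CNFFormula.Satisfiable
      fun F => (2 ^ scopeBound (g F.n) F.n + F.code.size + 1) ^ e' + V F + k := by
  -- One program prepares the flag `g n < 2`, the answer of the exhaustive search and the CSP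
  -- instance. The flag then selects that answer or a call of `q`, before which the variables are
  -- cleared.
  obtain ⟨⟨p, T, ⟨e', hT⟩, hp⟩, -⟩ : PT (fun x : RawCNF => 2 ^ scopeBound (g x.1) x.1) fun x =>
      (decide (g x.1 < 2), !(rel x.2 (if g x.1 < 2 then List.range x.1 else [])).isEmpty,
        reduction (g x.1) x.1 x.2) :=
    ((hg.comp₀ (f := fun x : RawCNF => x.1) (by fun_prop)).lt (.const 2)).prodMk
      ((rel_range_PT hg).prodMk (reduction_PT hg))
  refine ⟨.seq p (.ite (.hd (.var 0)) (.assign 0 (.hd (.tl (.var 0))))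
    (.seq (.assign 0 (.tl (.tl (.var 0)))) (.seq (clear q.bound) q))),
    2 * q.bound + 20, e', fun F hF => ?_⟩
  have hsz : sz F.raw = F.code.size := by rw [sz, F.enc_raw]
  have hlt : ∀ C ∈ F.raw.2, ∀ l ∈ C, l.1 < F.n := by
    intro C hC l hl
    obtain ⟨C, -, rfl⟩ := List.mem_map.1 hC
    obtain ⟨l, -, rfl⟩ := List.mem_map.1 hl
    exact l.1.2
  have hw : ∀ C ∈ F.raw.2, C.length ≤ 3 := by
    intro C hC
    obtain ⟨C, hC', rfl⟩ := List.mem_map.1 hC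
    simpa using hF C hC'
  have hT' := hT F.raw
  rw [hsz] at hT'
  have hrun := hp F.raw (initStore F.code) (by simp [initStore, F.enc_raw])
  suffices h : Run (.seq p (.ite (.hd (.var 0)) (.assign 0 (.hd (.tl (.var 0))))
      (.seq (.assign 0 (.tl (.tl (.var 0)))) (.seq (clear q.bound) q)))) (initStore F.code)
      (T F.raw + (3 + (4 + (2 * q.bound + 1 + V F)))) fun s => s 0 ≠ .nil ↔ F.Satisfiable by
    obtain ⟨s, t, h1, h2, h3⟩ := h
    exact ⟨s, t, h1, h2.trans (by dsimp only [CNFFormula.raw] at *; omega), h3⟩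
  refine hrun.seq fun s hs => Run.ite (fun hc => ?_) fun hc => ?_
  · have hb : g F.n < 2 := by
      by_contra hb
      rw [Expr.eval, Expr.eval, hs, enc_prod] at hc
      refine hc ?_
      dsimp only [CNFFormula.raw]
      rw [decide_eq_false hb]; rfl
    refine (Run.assign (Q := fun s => s 0 ≠ .nil ↔ F.Satisfiable) ?_).mono
      (by simp only [Expr.cost]; omega) fun _ h => h
    have hval : Expr.eval s (.hd (.tl (.var 0))) =
        Enc.enc (!(rel F.raw.2 (List.range F.n)).isEmpty) := by
      rw [← if_pos (c := g F.n < 2) (t := List.range F.n) (e := []) hb]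
      simp only [Expr.eval, hs]; rfl
    rw [Function.update_self, hval, ← F.satisfiable_raw, ← rel_range_ne_nil_iff hlt]
    cases rel F.raw.2 (List.range F.n) <;> simp [Enc.enc, Val.ofBool]
  · have hb : 2 ≤ g F.n := by
      by_contra! hb
      rw [Expr.eval, Expr.eval, hs, enc_prod] at hc
      dsimp only [CNFFormula.raw] at hc
      rw [decide_eq_true hb] at hc
      simp [Enc.enc, Val.ofBool, Val.hd] at hc
    obtain ⟨I, hI, hnorm, hcons⟩ := exists_instance_reduction hb (hgn F.n) F.raw.2
    have hIn : I.n = F.n := congrArg Prod.fst hI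
    have hId : I.d = 2 := congrArg (fun x => x.2.1) hI
    obtain ⟨s', t, h1, h2, h3⟩ := hq I (hK I hnorm (by rwa [hIn]) (by rwa [hIn]))
    have hUV : U I ≤ V F := by
      refine hU F I hIn hId ?_
      have := he F.raw
      rw [← hsz, ← I.enc_raw, hI]
      exact this
    refine Run.mono (T := 4 + (2 * q.bound + 1 + t)) (Run.seq (Q := fun s => s 0 = I.code)
      (Run.assign ?_) fun s hs => run_clear_seq h1 hs) (by omega) fun s hs => ?_
    · rw [Function.update_self, ← I.enc_raw, hI]
      simp only [Expr.eval, hs]; rfl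
    · rw [hs, h3, ← F.satisfiable_raw, ← I.consistent_raw, hI,
        reduction_consistent (by omega) hw hlt]

/-- The exponent of the running time of the reduction is sublinear. -/
theorem effLittleO_add_scopeBound {f : ℕ → ℕ} (hf : EffLittleO f fun n => n) (hc : Computable g)
    (hm : Monotone g) (hu : ∀ b, ∃ n, b ≤ g n) (hgn : ∀ n, g n ≤ n) (E : ℕ) :
    EffLittleO (fun n => f n + scopeBound (g n) n * E) fun n => n := by
  obtain ⟨hf, hid, μ, n₀, hμ, hμm, hμu, h⟩ := hf
  have hw : Computable fun n => scopeBound (g n) n :=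
    Primrec.nat_mul.to_comp.comp (.const 3) (Primrec.nat_add.to_comp.comp
      (Primrec.nat_div.to_comp.comp .id (Primrec.nat_max.to_comp.comp hc (.const 1))) (.const 1))
  refine ⟨Primrec.nat_add.to_comp.comp hf (Primrec.nat_mul.to_comp.comp hw (.const E)), hid,
    -- Write `m` for this value. Halving gives `f n * m ≤ n / 2`, and the factor `12 * (E + 1)`
    -- against the `6` of `scopeBound_mul_le` gives `scopeBound (g n) n * E * m ≤ n / 4`.
    fun n => min (μ n) (g n / (12 * (E + 1))) / 2, n₀, ?_, fun n n' hn => ?_, fun b => ?_,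
    fun n hn => ?_⟩
  · exact Primrec.nat_div.to_comp.comp (Primrec.nat_min.to_comp.comp hμ
      (Primrec.nat_div.to_comp.comp hc (.const _))) (.const 2)
  · exact Nat.div_le_div_right (min_le_min (hμm hn) (Nat.div_le_div_right (hm hn)))
  · obtain ⟨n₁, h₁⟩ := hμu (2 * b)
    obtain ⟨n₂, h₂⟩ := hu (2 * b * (12 * (E + 1)))
    refine ⟨max n₁ n₂, ?_⟩
    rw [Nat.le_div_iff_mul_le (by omega), mul_comm]
    refine le_min (h₁.trans (hμm (le_max_left _ _))) ?_
    rw [Nat.le_div_iff_mul_le (by omega)]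
    exact h₂.trans (hm (le_max_right _ _))
  · dsimp only
    set X := g n / (12 * (E + 1)) with hX
    set m := min (μ n) X / 2 with hmdef
    have h1 : 2 * m ≤ μ n := by omega
    have h2 : 2 * m ≤ X := by omega
    have h3 := h n hn
    have h4 : X * (12 * (E + 1)) ≤ g n := Nat.div_mul_le_self _ _
    have h5 := scopeBound_mul_le (hgn n)
    have h6 : scopeBound (g n) n * (2 * m * (12 * (E + 1))) ≤ 6 * n :=
      (Nat.mul_le_mul_left _ ((Nat.mul_le_mul_right _ h2).trans h4)).trans h5
    have h7 : f n * (2 * m) ≤ n := (Nat.mul_le_mul_left _ h1).trans h3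
    nlinarith [Nat.zero_le (scopeBound (g n) n * m)]

end

/-- A computable, nondecreasing, unbounded function that is at most the fourth root of `lam`. -/
theorem exists_slow_root {lam : ℕ → ℕ} (hc : Computable lam) (hm : Monotone lam)
    (hu : ∀ b, ∃ n, b ≤ lam n) : ∃ g : ℕ → ℕ, PT (fun _ => 0) g ∧ Computable g ∧ Monotone g ∧
      (∀ b, ∃ n, b ≤ g n) ∧ (∀ n, g n ≤ n) ∧ ∀ n, 2 ≤ g n → g n ^ 3 + 1 ≤ lam n := by
  -- The minimum with `n` ensures that no residue class is empty. The fourth root leaves room for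
  -- the extra constraint: `g ^ 3 + 1 ≤ 2 * g ^ 3 ≤ g ^ 4` if `2 ≤ g`.
  obtain ⟨g, h1, h2, h3, h4, h5⟩ := exists_slow (lam := fun n => min n (lam n).sqrt.sqrt)
    (Primrec.nat_min.to_comp.comp .id (Primrec.nat_sqrt.to_comp.comp
      (Primrec.nat_sqrt.to_comp.comp hc)))
    (fun n n' h => min_le_min h (Nat.sqrt_le_sqrt (Nat.sqrt_le_sqrt (hm h)))) fun b => by
      obtain ⟨n, hn⟩ := hu (b * b * (b * b))
      refine ⟨max n b, le_min (le_max_right _ _) ?_⟩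
      rw [Nat.le_sqrt, Nat.le_sqrt]
      exact hn.trans (hm (le_max_left _ _))
  refine ⟨g, h1, h2, h3, h4, fun n => (h5 n).trans (min_le_left _ _), fun n hn => ?_⟩
  have h6 := (h5 n).trans (min_le_right _ _)
  rw [Nat.le_sqrt, Nat.le_sqrt] at h6
  have h7 : 2 * g n ^ 3 ≤ g n * g n ^ 3 := Nat.mul_le_mul_right _ hn
  have h8 : 1 ≤ g n ^ 3 := Nat.one_le_pow _ _ (by omega)
  have h9 : g n * g n * (g n * g n) = g n * g n ^ 3 := by ring
  omega

/-- A subexponential algorithm for normalized instances with at most `lam n` constraints yields one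
for `3`-CNF-Sat. -/
theorem kSatSubexp_of_subexpTime {lam : ℕ → ℕ} (hc : Computable lam) (hm : Monotone lam)
    (hu : ∀ b, ∃ n, b ≤ lam n)
    (h : CSPInstance.SubexpTime {I | I.Normalized ∧ I.cons ≤ lam I.n}) :
    CNFFormula.KSatSubexp 3 := by
  obtain ⟨g, hg, hgc, hgm, hgu, hgn, hgl⟩ := exists_slow_root hc hm hu
  obtain ⟨q, f, a, c, hf, hq⟩ := h
  obtain ⟨e, he⟩ := (reduction_PT hg).2
  obtain ⟨p, k, e', hp⟩ := exists_sat_program hg hgn hq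
    (fun I hI h2 hI' => ⟨hI, hI'.trans (hgl _ h2)⟩)
    (V := fun F => a * 2 ^ f F.n * ((2 ^ scopeBound (g F.n) F.n + F.code.size + 1) ^ e) ^ c)
    (fun F I hn hd hs => by
      dsimp only
      rw [hn, hd]
      exact Nat.mul_le_mul_left _ (Nat.pow_le_pow_left hs c)) he
  refine ⟨p, _, (1 + a + k) * 3 ^ (e' + e * c), e' + e * c,
    effLittleO_add_scopeBound hf hgc hgm hgu hgn (e' + e * c), fun F hF => ?_⟩
  obtain ⟨s, t, h1, h2, h3⟩ := hp F hF
  refine ⟨s, t, h1, h2.trans ?_, h3⟩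
  set E := e' + e * c with hE
  set w := scopeBound (g F.n) F.n
  set z := F.code.size with hz
  have hz1 : 1 ≤ z := F.code.size_pos
  have hw1 : 1 ≤ 2 ^ w := Nat.one_le_two_pow
  set Q := 2 ^ w + z + 1 with hQ
  have hQ1 : 1 ≤ Q := by omega
  -- From `2 ^ w + z + 1 ≤ 3 * 2 ^ w * z`, all quantities being positive. The factor `2 ^ (w * E)`
  -- joins the exponent `f n`, while `z ^ E` is the polynomial part.
  have hQE : Q ^ E ≤ 2 ^ (w * E) * 3 ^ E * z ^ E := by
    rw [pow_mul, ← mul_pow, ← mul_pow]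
    exact Nat.pow_le_pow_left (by nlinarith) E
  have h4 : Q ^ e' ≤ Q ^ E := Nat.pow_le_pow_right hQ1 (by omega)
  have h5 : (Q ^ e) ^ c ≤ Q ^ E := by
    rw [← pow_mul]; exact Nat.pow_le_pow_right hQ1 (by omega)
  have h6 : 1 ≤ Q ^ E := Nat.one_le_pow _ _ hQ1
  have h7 : 1 ≤ 2 ^ f F.n := Nat.one_le_two_pow
  have h8 : Q ^ E ≤ 2 ^ f F.n * Q ^ E := Nat.le_mul_of_pos_left _ h7
  have h9 : k * 1 ≤ k * (2 ^ f F.n * Q ^ E) := Nat.mul_le_mul_left k (h6.trans h8)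
  calc Q ^ e' + a * 2 ^ f F.n * (Q ^ e) ^ c + k
      ≤ 2 ^ f F.n * Q ^ E + a * 2 ^ f F.n * Q ^ E + k * (2 ^ f F.n * Q ^ E) :=
        add_le_add (add_le_add (h4.trans h8) (Nat.mul_le_mul_left _ h5)) (by omega)
    _ = (1 + a + k) * 2 ^ f F.n * Q ^ E := by ring
    _ ≤ (1 + a + k) * 2 ^ f F.n * (2 ^ (w * E) * 3 ^ E * z ^ E) := Nat.mul_le_mul_left _ hQE
    _ = (1 + a + k) * 3 ^ E * 2 ^ (f F.n + w * E) * z ^ E := by rw [pow_add]; ring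

theorem mainTheorem7 :
    (∀ c : ℕ, CSPInstance.PolyTime {I : CSPInstance | I.cons ≤ c}) ∧
    (ETH → ∀ lam : ℕ → ℕ, Computable lam → Monotone lam → (∀ B : ℕ, ∃ n : ℕ, B ≤ lam n) →
      ¬ CSPInstance.SubexpTime {I : CSPInstance | I.Normalized ∧ I.cons ≤ lam I.n}) :=
  ⟨CSPInstance.polyTime_of_cons_le, fun h _ hc hm hu hs =>
    h 3 le_rfl (kSatSubexp_of_subexpTime hc hm hu hs)⟩
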